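/- Let $M$ be a non-empty (Hausdorff, smooth) $5$-manifold with an irreducible $SO(3)$-structure, i.e. a reduction of its frame bundle to $\iota(SO(3))\subset SO(5)$, where $\iota$ is given by the irreducible representation $\rho(h)x=\mu^{-1}(h\mu(x)h^{-1})$ of $SO(3)$ on $\mathbb R^5$ and $$\mu(x)=\begin{pmatrix} \frac{x_1}{\sqrt3}-x_4 & x_2 & x_3\\ x_2 & \frac{x_1}{\sqrt3}+x_4 & x_5\\ x_3& x_5& -\frac{2x_1}{\sqrt3}\end{pmatrix}.$$ The frames of the reduction are called adapted; they define a Riemannian metric $g$, an orientation, and a symmetric $3$-tensor $\Upsilon$ with $\Upsilon(x,x,x)=\frac{3\sqrt3}{2}\det\mu(x)$ in adapted frames. With $g(\Upsilon_v x,y)=\Upsilon(v,x,y)$ and $\widehat\Upsilon(W)=4\sum_j\Upsilon_{W(a_j)}\circ\Upsilon_{a_j}$ for $W\in\otimes^2TM\cong\mathrm{End}(TM)$ ($a_j$ adapted), let $\Lambda^2_3TM=\{W:\widehat\Upsilon(W)=7W\}\subset\Lambda^2TM$. For an adapted frame $E=(E_1,\dots,E_5)$ put $$\kappa_1=\sqrt3E_1\wedge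 E_5+E_2\wedge E_3+E_4\wedge E_5,\quad \kappa_2=\sqrt3E_1\wedge E_3+E_2\wedge E_5+E_3\wedge E_4,\quad \kappa_3=2E_2\wedge E_4+E_3\wedge E_5;$$ this is an orthogonal basis of $\Lambda^2_3TM$, $|\kappa_i|^2=5$, where $g(x\wedge y,u\wedge v)=g(x,u)g(y,v)-g(x,v)g(y,u)$. Let $\nabla$ be a smooth $SO(3)$-connection on $M$, i.e. a connection on $TM$ preserving the reduction. The twistor space is $\mathbb T=\{\sigma\in\Lambda^2_3TM:|\sigma|^2=5\}$ with projection $\pi:\mathbb T\to M$. Its tangent bundle is $T\mathbb T=\mathcal V\oplus\mathcal H$, with $\mathcal V_\sigma=\sigma^\perp\subset\Lambda^2_3T_{\pi(\sigma)}M$ the vertical and $\mathcal H$ the $\nabla$-horizontal space; $X^h_\sigma$ denotes the horizontal lift of $X$. Put $\xi_\sigma=\frac14*(\sigma\wedge\sigma)$, $\chi_\sigma=(\xi_\sigma)^h_\sigma$ and, for $t>0$, $h_t(X^h_\sigma+V,Y^h_\sigma+W)=g(X,Y)+t\,g(V,W)$. Let $\sigma_\pm$ be the self-dual and anti-self-dual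 parts of $\sigma$ in $\Lambda^2(\xi_\sigma^\perp)$, let $g(\varphi^\sigma_\pm X,Y)=\frac{2}{2\pm1}g(\sigma_\pm,X\wedge Y)$, and for $n=1,2$ let $\Phi^{(n)}_\pm X^h_\sigma=(\varphi^\sigma_\pm X)^h_\sigma$ and $\Phi^{(n)}_\pm V=(-1)^n\sigma\times V$ for $V\in\mathcal V_\sigma$, where $\times$ is the vector product on $\Lambda^2_3T_{\pi(\sigma)}M$ with $\kappa_1\times\kappa_2=\kappa_3$ and its cyclic permutations. **Proposition.** For every choice of the sign, of $n\in\{1,2\}$ and of $t>0$, the contact distribution $\{w\in T\mathbb T: h_t(w,\chi)=0\}$ (of rank $6$) of the almost contact metric structure $(\Phi^{(n)}_\pm,\chi,h_t)$ on $\mathbb T$ is not integrable: it is not true that an integral manifold passes through every point of $\mathbb T$, and the distribution is not involutive. More precisely, let $\sigma\in\mathbb T$ and $p=\pi(\sigma)$. There is an adapted frame $E_1,\dots,E_5$ near $p$ with $\nabla E_\alpha|_p=0$ for all $\alpha$ and $\kappa_3|_p=\sigma$. For every such frame, with $y_i(\tau)=\frac15g(\tau,\kappa_i)$, the vector fields $$\widetilde\kappa_1(\tau)=\kappa_1-\tfrac15g(\kappa_1,\tau)\tau\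 \text{(vertical)},\qquad A=\sqrt3\,y_1y_3E_1^h-\left(\tfrac12y_1^2+\tfrac12y_2^2-y_3^2\right)E_3^h$$ are smooth sections of the contact distribution over the domain of the frame, and $$[\widetilde\kappa_1,A]_\sigma=\sqrt3\,(E_1)^h_\sigma=-\sqrt3\,\chi_\sigma,$$ which does not lie in the contact distribution. -/

import Mathlib

open Bundle Filter Topology
open scoped Manifold ContDiff Matrix

noncomputable section

namespace SO3Twistor

/-! ### Linear algebra of the irreducible representation of `SO(3)` on `ℝ⁵` -/

/-- Euclidean `ℝ⁵`. The coordinates `x₁, …, x₅` are `x 0, …, x 4`. -/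
abbrev E5 : Type := EuclideanSpace ℝ (Fin 5)

/-- The standard basis vectors of `ℝ⁵`. -/
def stdVec (i : Fin 5) : E5 := EuclideanSpace.single i (1 : ℝ)

/-- The isomorphism `μ` of `ℝ⁵` onto the traceless symmetric real `3 × 3` matrices. -/
def mu (x : E5) : Matrix (Fin 3) (Fin 3) ℝ :=
  !![x 0 / √3 - x 3, x 1, x 2;
     x 1, x 0 / √3 + x 3, x 4;
     x 2, x 4, -2 * (x 0 / √3)]

/-- The image of `SO(3)` in the linear automorphisms of `ℝ⁵` under the irreducible representation
`ρ(h) x = μ⁻¹(h μ(x) h⁻¹)` (for `h ∈ SO(3)` one has `h⁻¹ = hᵀ`). -/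
def irrSO3 : Set (E5 ≃L[ℝ] E5) :=
  {T | ∃ h ∈ Matrix.specialOrthogonalGroup (Fin 3) ℝ, ∀ x, mu (T x) = h * mu x * hᵀ}

/-- The cubic form `Υ(x,x,x) = (3√3/2) det μ(x)`. -/
def upsilonCubic (x : E5) : ℝ := 3 * √3 / 2 * (mu x).det

/-- The symmetric trilinear form `Υ`, the polarization of the cubic form. -/
def upsilon (x y z : E5) : ℝ :=
  (upsilonCubic (x + y + z) - upsilonCubic (x + y) - upsilonCubic (y + z) - upsilonCubic (x + z)
    + upsilonCubic x + upsilonCubic y + upsilonCubic z) / 6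

/-- The endomorphism `Υ_v` of `ℝ⁵`, `g(Υ_v x, y) = Υ(v, x, y)`. -/
def upsilonEnd (v x : E5) : E5 := ∑ k, upsilon v x (stdVec k) • stdVec k

/-- `Υ̂(W) x = 4 ∑ⱼ Υ_{W eⱼ} (Υ_{eⱼ} x)`. Elements `W` of `⊗²ℝ⁵` are viewed as endomorphisms by
`g(W x, y) = g(W, x ⊗ y)`. -/
def upsilonHat (W : E5 →L[ℝ] E5) (x : E5) : E5 :=
  (4 : ℝ) • ∑ j, upsilonEnd (W (stdVec j)) (upsilonEnd (stdVec j) x)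

/-- The space `Λ²₃ ⊂ Λ²ℝ⁵`: the eigenspace of `Υ̂` on `⊗²ℝ⁵` for the eigenvalue `7`. -/
def Lambda23 : Set (E5 →L[ℝ] E5) := {F | ∀ x, upsilonHat F x = (7 : ℝ) • F x}

/-- The two-vector `eᵢ ∧ eⱼ` as the skew-symmetric endomorphism `x ↦ g(eᵢ, x) eⱼ - g(eⱼ, x) eᵢ`,
that is, `g(F x, y) = g(eᵢ ∧ eⱼ, x ∧ y)`. -/
def wedge (i j : Fin 5) : E5 →L[ℝ] E5 :=
  (EuclideanSpace.proj i : E5 →L[ℝ] ℝ).smulRight (stdVec j)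
    - (EuclideanSpace.proj j : E5 →L[ℝ] ℝ).smulRight (stdVec i)

/-- The two-vectors `κ₁, κ₂, κ₃` (here `kappa 0, kappa 1, kappa 2`) of the standard basis. -/
def kappa : Fin 3 → (E5 →L[ℝ] E5) :=
  ![√3 • wedge 0 4 + wedge 1 2 + wedge 3 4,
    √3 • wedge 0 2 + wedge 1 4 + wedge 2 3,
    (2 : ℝ) • wedge 1 3 + wedge 2 4]

/-- The inner product on endomorphisms which on two-vectors is
`g(x ∧ y, u ∧ v) = g(x,u) g(y,v) - g(x,v) g(y,u)`. -/
def innerEnd (F G : E5 →L[ℝ] E5) : ℝ := (1 / 2) * ∑ j, inner ℝ (F (stdVec j)) (G (stdVec j))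

/-- The component `g(F, eⱼ ∧ eₖ) = g(F eⱼ, eₖ)` of a two-vector. -/
def entry (F : E5 →L[ℝ] E5) (j k : Fin 5) : ℝ := (F (stdVec j)) k

/-- The vector `ξ_F = ¼ ∗(F ∧ F)`. Its component along `eᵢ` is one quarter of the coefficient of
`eᵢ ∧ F ∧ F` with respect to `e₁ ∧ ⋯ ∧ e₅`, where `F = ½ ∑ g(F, eⱼ ∧ eₖ) eⱼ ∧ eₖ`. -/
def xi (F : E5 →L[ℝ] E5) : E5 :=
  ∑ s : Equiv.Perm (Fin 5),
    ((1 / 16 : ℝ) * ((Equiv.Perm.sign s : ℤ) : ℝ) * entry F (s 1) (s 2) * entry F (s 3) (s 4))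
      • stdVec (s 0)

/-- The Hodge star operator on two-vectors of the oriented Euclidean space `H = v^⊥`
(`v` a unit vector; `v` followed by an oriented basis of `H` is an oriented basis of `ℝ⁵`):
`(∗F)ⱼₖ = ½ ∑ ε_{ijklm} vᵢ F_{lm}`. -/
def starPerp (v : E5) (F : E5 →L[ℝ] E5) : E5 →L[ℝ] E5 :=
  ∑ s : Equiv.Perm (Fin 5),
    ((1 / 2 : ℝ) * ((Equiv.Perm.sign s : ℤ) : ℝ) * v (s 0) * entry F (s 3) (s 4))
      • (EuclideanSpace.proj (s 1) : E5 →L[ℝ] ℝ).smulRight (stdVec (s 2))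

/-- For a sign `ε`, the self-dual (`ε = 1`) or anti-self-dual (`ε = -1`) part `F_ε` of `F`
in `Λ²H`, `H = ξ_F^⊥`. -/
def dualPart (ε : ℤˣ) (F : E5 →L[ℝ] E5) : E5 →L[ℝ] E5 :=
  (1 / 2 : ℝ) • (F + ((ε : ℤ) : ℝ) • starPerp (xi F) F)

/-- The partially complex structure `φ_ε`, `g(φ_ε X, Y) = (2 / (2 + ε)) g(F_ε, X ∧ Y)`. -/
def phi (ε : ℤˣ) (F : E5 →L[ℝ] E5) : E5 →L[ℝ] E5 :=
  (2 / (2 + ((ε : ℤ) : ℝ))) • dualPart ε F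

/-- The coordinates `yᵢ = g(F, κᵢ) / 5`. -/
def coordY (F : E5 →L[ℝ] E5) (i : Fin 3) : ℝ := innerEnd F (kappa i) / 5

/-- The vector product on `Λ²₃` for which `κ₁, κ₂, κ₃` is oriented and `κ₁ × κ₂ = κ₃`. -/
def cross (F G : E5 →L[ℝ] E5) : E5 →L[ℝ] E5 :=
  (coordY F 1 * coordY G 2 - coordY F 2 * coordY G 1) • kappa 0
    + (coordY F 2 * coordY G 0 - coordY F 0 * coordY G 2) • kappa 1
    + (coordY F 0 * coordY G 1 - coordY F 1 * coordY G 0) • kappa 2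

/-! ### Distributions on subsets of manifolds -/

section Distributions

variable {E : Type*} [NormedAddCommGroup E] [NormedSpace ℝ E] {H : Type*} [TopologicalSpace H]
  (I : ModelWithCorners ℝ E H) {N : Type*} [TopologicalSpace N] [ChartedSpace H N]
  [IsManifold I ∞ N]

/-- `A` is a smooth section of the distribution `D` on the submanifold `S` of `N`, over the open
subset `S ∩ W` of `S`, given as the restriction to `S` of a smooth vector field on the open subset
`W` of `N`. (The fibres of `D` consist of vectors tangent to `S`, so that `A` is tangent to `S`,
and the Lie bracket of two such fields in `N` restricts on `S` to the Lie bracket in `S`.) -/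
def IsSectionOn (S : Set N) (D : ∀ x : N, Set (TangentSpace I x)) (W : Set N)
    (A : ∀ x : N, TangentSpace I x) : Prop :=
  ContMDiffOn I I.tangent ∞ (fun x => (⟨x, A x⟩ : TangentBundle I N)) W ∧
    ∀ x ∈ S ∩ W, A x ∈ D x

/-- The distribution `D` on `S` is involutive: the Lie bracket of any two smooth local sections
is a section. -/
def IsInvolutive (S : Set N) (D : ∀ x : N, Set (TangentSpace I x)) : Prop :=
  ∀ W : Set N, IsOpen W → ∀ A B : ∀ x : N, TangentSpace I x,
    IsSectionOn I S D W A → IsSectionOn I S D W B →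
      ∀ x ∈ S ∩ W, VectorField.mlieBracket I A B x ∈ D x

/-- The distribution `D` of rank `k` on `S` is integrable: through every point of `S` there passes
an (immersed) integral manifold of `D`. -/
def IsIntegrable (k : ℕ) (S : Set N) (D : ∀ x : N, Set (TangentSpace I x)) : Prop :=
  ∀ x ∈ S, ∃ (W : Set (EuclideanSpace ℝ (Fin k))) (f : EuclideanSpace ℝ (Fin k) → N),
    IsOpen W ∧ (0 : EuclideanSpace ℝ (Fin k)) ∈ W ∧ f 0 = x ∧
    ContMDiffOn (𝓡 k) I ∞ f W ∧
    ∀ w ∈ W, f w ∈ S ∧ Function.Injective (mfderiv (𝓡 k) I f w) ∧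
      Set.range (mfderiv (𝓡 k) I f w) = D (f w)

end Distributions

/-! ### Irreducible `SO(3)`-structures and `SO(3)`-connections -/

section Manifold

variable {M : Type*} [TopologicalSpace M] [ChartedSpace E5 M] [IsManifold (𝓡 5) ∞ M]

/-- The vector field with constant components `x` with respect to a frame `e`, as a map into the
tangent bundle. -/
def frameField (e : ∀ q : M, E5 ≃L[ℝ] TangentSpace (𝓡 5) q) (x : E5) (q : M) :
    TangentBundle (𝓡 5) M :=
  ⟨q, e q x⟩

variable (M) in
/-- An irreducible `SO(3)`-structure on a `5`-manifold: a reduction of the frame bundle to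
`ι(SO(3))`. A frame `e₁ ↦ a₁, …, e₅ ↦ a₅` of `T_pM` is a linear isomorphism `ℝ⁵ → T_pM`;
`adapted p` is the fibre over `p` of the reduced bundle. -/
structure IrreducibleSO3Structure where
  adapted : ∀ p : M, Set (E5 ≃L[ℝ] TangentSpace (𝓡 5) p)
  mem_adapted_iff : ∀ (p : M), ∀ u ∈ adapted p, ∀ v : E5 ≃L[ℝ] TangentSpace (𝓡 5) p,
    v ∈ adapted p ↔ ∃ T ∈ irrSO3, ∀ x, v x = u (T x)
  exists_frame : ∀ p : M, ∃ (U : Set M) (e : ∀ q : M, E5 ≃L[ℝ] TangentSpace (𝓡 5) q),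
    IsOpen U ∧ p ∈ U ∧ (∀ q ∈ U, e q ∈ adapted q) ∧
      ∀ x, ContMDiffOn (𝓡 5) (𝓡 5).tangent ∞ (frameField e x) U

variable (S : IrreducibleSO3Structure M)

/-- A smooth adapted frame on an open set `U` (the values outside `U` are irrelevant). -/
structure IsAdaptedFrame (U : Set M) (e : ∀ q : M, E5 ≃L[ℝ] TangentSpace (𝓡 5) q) : Prop where
  isOpen : IsOpen U
  mem : ∀ q ∈ U, e q ∈ S.adapted q
  smooth : ∀ x, ContMDiffOn (𝓡 5) (𝓡 5).tangent ∞ (frameField e x) U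

lemma adapted_nonempty (p : M) : (S.adapted p).Nonempty := by
  obtain ⟨U, e, -, hp, he, -⟩ := S.exists_frame p
  exact ⟨e p, he p hp⟩

/-- Some adapted frame of `T_pM`. The tensors below are transferred from `ℝ⁵` by it; being
`ι(SO(3))`-invariant on `ℝ⁵`, they do not depend on its choice. -/
def someFrame (p : M) : E5 ≃L[ℝ] TangentSpace (𝓡 5) p := (adapted_nonempty S p).some

/-- The Riemannian metric `g`. -/
def metric (p : M) (X Y : TangentSpace (𝓡 5) p) : ℝ :=
  inner ℝ ((someFrame S p).symm X) ((someFrame S p).symm Y)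

/-- The expression of an endomorphism of `T_pM` in an adapted frame. -/
def toModel (p : M) (F : TangentSpace (𝓡 5) p →L[ℝ] TangentSpace (𝓡 5) p) : E5 →L[ℝ] E5 :=
  ((someFrame S p).symm : TangentSpace (𝓡 5) p →L[ℝ] E5) ∘L F ∘L
    (someFrame S p : E5 →L[ℝ] TangentSpace (𝓡 5) p)

/-- The endomorphism `u ∘ F ∘ u⁻¹` of `T_pM` with expression `F` in the frame `u`. -/
def conjFrame {p : M} (u : E5 ≃L[ℝ] TangentSpace (𝓡 5) p) (F : E5 →L[ℝ] E5) :
    TangentSpace (𝓡 5) p →L[ℝ] TangentSpace (𝓡 5) p :=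
  (u : E5 →L[ℝ] TangentSpace (𝓡 5) p) ∘L F ∘L (u.symm : TangentSpace (𝓡 5) p →L[ℝ] E5)

/-- The space `Λ²₃T_pM`, its elements being viewed as (skew-symmetric) endomorphisms of `T_pM`. -/
def Lambda23At (p : M) : Set (TangentSpace (𝓡 5) p →L[ℝ] TangentSpace (𝓡 5) p) :=
  {F | toModel S p F ∈ Lambda23}

/-- The metric `g` on `Λ²₃T_pM`. -/
def innerAt (p : M) (F G : TangentSpace (𝓡 5) p →L[ℝ] TangentSpace (𝓡 5) p) : ℝ :=
  innerEnd (toModel S p F) (toModel S p G)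

/-- The vector `ξ_σ = ¼ ∗(σ ∧ σ)` in `T_pM`. -/
def xiAt (p : M) (F : TangentSpace (𝓡 5) p →L[ℝ] TangentSpace (𝓡 5) p) : TangentSpace (𝓡 5) p :=
  someFrame S p (xi (toModel S p F))

/-- The partially complex structure `φ^σ_±` of `T_pM`. -/
def phiAt (ε : ℤˣ) (p : M) (F : TangentSpace (𝓡 5) p →L[ℝ] TangentSpace (𝓡 5) p) :
    TangentSpace (𝓡 5) p →L[ℝ] TangentSpace (𝓡 5) p :=
  conjFrame (someFrame S p) (phi ε (toModel S p F))

/-- The vector product on `Λ²₃T_pM`. -/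
def crossAt (p : M) (F G : TangentSpace (𝓡 5) p →L[ℝ] TangentSpace (𝓡 5) p) :
    TangentSpace (𝓡 5) p →L[ℝ] TangentSpace (𝓡 5) p :=
  conjFrame (someFrame S p) (cross (toModel S p F) (toModel S p G))

/-- Covariant derivatives on the tangent bundle of `M`; `nabla Y p X` is `∇_X Y` at `p`. -/
abbrev Connection (M : Type*) [TopologicalSpace M] [ChartedSpace E5 M]
    [IsManifold (𝓡 5) ∞ M] :=
  CovariantDerivative (𝓡 5) E5 (TangentSpace (𝓡 5) : M → Type _)

/-- `∇` is an `SO(3)`-connection: its connection form with respect to any adapted frame takes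
values in the Lie algebra of `ι(SO(3))`, which consists of the endomorphisms
`dρ(a) x = μ⁻¹(a μ(x) - μ(x) a)` with `a` a skew-symmetric `3 × 3` matrix. -/
def IsSO3Connection (nabla : Connection M) : Prop :=
  ∀ (U : Set M) (e : ∀ q : M, E5 ≃L[ℝ] TangentSpace (𝓡 5) q), IsAdaptedFrame S U e →
    ∀ p ∈ U, ∀ X : TangentSpace (𝓡 5) p, ∃ a : Matrix (Fin 3) (Fin 3) ℝ, aᵀ = -a ∧
      ∀ x : E5, mu ((e p).symm (nabla (fun q => e q x) p X)) = a * mu x - mu x * a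

/-! ### The twistor space and its almost contact metric structures -/

/-- The total space of the bundle `End(TM)`, a smooth manifold. By means of `g` it contains
`Λ²TM`, as the skew-symmetric endomorphisms. -/
abbrev EndBundle (M : Type*) [TopologicalSpace M] [ChartedSpace E5 M]
    [IsManifold (𝓡 5) ∞ M] :=
  TotalSpace (E5 →L[ℝ] E5)
    (fun p : M => TangentSpace (𝓡 5) p →L[ℝ] TangentSpace (𝓡 5) p)

/-- The model of the manifold `End(TM)`. -/
abbrev endModel := (𝓡 5).prod 𝓘(ℝ, E5 →L[ℝ] E5)

/-- The twistor space `𝕋 = {σ ∈ Λ²₃TM : |σ|² = 5}`, as a subset of `End(TM)`. -/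
def twistorSpace : Set (EndBundle M) :=
  {σ | σ.2 ∈ Lambda23At S σ.1 ∧ innerAt S σ.1 σ.2 σ.2 = 5}

/-- The projection `dπ : T_σ End(TM) → T_{π(σ)}M`. -/
def dproj (σ : EndBundle M) :
    TangentSpace endModel σ →L[ℝ] TangentSpace (𝓡 5) σ.1 :=
  mfderiv endModel (𝓡 5) (TotalSpace.proj : EndBundle M → M) σ

/-- The vertical tangent vector at `σ` given by an element `v` of the fibre through `σ`: the
velocity of the curve `t ↦ σ + t v`. -/
def vertLift (σ : EndBundle M) (v : TangentSpace (𝓡 5) σ.1 →L[ℝ] TangentSpace (𝓡 5) σ.1) :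
    TangentSpace endModel σ :=
  mfderiv 𝓘(ℝ, ℝ) endModel (fun t : ℝ => (⟨σ.1, σ.2 + t • v⟩ : EndBundle M)) 0 (1 : ℝ)

/-- `w` is the horizontal lift of `X` at `σ` with respect to `∇`: there is a smooth local section
`s` of `End(TM)` with `s = σ` and `∇_X s = 0` at `p = π(σ)`, and `w = ds(X)`. Here
`(∇_X s) Y = ∇_X (s Y) - s (∇_X Y)`. -/
def IsHorizontalLift (nabla : Connection M) (σ : EndBundle M) (X : TangentSpace (𝓡 5) σ.1)
    (w : TangentSpace endModel σ) : Prop :=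
  ∃ s : ∀ q : M, TangentSpace (𝓡 5) q →L[ℝ] TangentSpace (𝓡 5) q,
    s σ.1 = σ.2 ∧
    ContMDiffAt (𝓡 5) endModel ∞ (fun q => (⟨q, s q⟩ : EndBundle M)) σ.1 ∧
    (∀ Y : ∀ q : M, TangentSpace (𝓡 5) q,
      MDifferentiableAt (𝓡 5) (𝓡 5).tangent (fun q => (⟨q, Y q⟩ : TangentBundle (𝓡 5) M)) σ.1 →
      nabla (fun q => s q (Y q)) σ.1 X = s σ.1 (nabla Y σ.1 X)) ∧
    w = mfderiv (𝓡 5) endModel (fun q => (⟨q, s q⟩ : EndBundle M)) σ.1 X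

/-- The horizontal lift `X^h_σ`, the unique vector with the property above. -/
def horLift (nabla : Connection M) (σ : EndBundle M) (X : TangentSpace (𝓡 5) σ.1) :
    TangentSpace endModel σ :=
  Classical.epsilon (IsHorizontalLift nabla σ X)

/-- The vertical component of `w`, as an element of the fibre through `σ`:
`w = (dπ w)^h + (vertical component)`. -/
def vertPart (nabla : Connection M) (σ : EndBundle M) (w : TangentSpace endModel σ) :
    TangentSpace (𝓡 5) σ.1 →L[ℝ] TangentSpace (𝓡 5) σ.1 :=
  Classical.epsilon (fun v => w = horLift nabla σ (dproj σ w) + vertLift σ v)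

/-- The vertical space `𝒱_σ` of `𝕋` at `σ`: the orthogonal complement of `σ` in `Λ²₃T_{π(σ)}M`. -/
def vertSpace (σ : EndBundle M) :
    Set (TangentSpace (𝓡 5) σ.1 →L[ℝ] TangentSpace (𝓡 5) σ.1) :=
  {v | v ∈ Lambda23At S σ.1 ∧ innerAt S σ.1 v σ.2 = 0}

/-- The tangent space `T_σ𝕋 = 𝒱_σ ⊕ ℋ_σ` of the twistor space. -/
def tangentTwistor (nabla : Connection M) (σ : EndBundle M) : Set (TangentSpace endModel σ) :=
  {w | ∃ v ∈ vertSpace S σ, ∃ X : TangentSpace (𝓡 5) σ.1, w = vertLift σ v + horLift nabla σ X}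

variable (M) in
/-- The data `(Φ, χ, h)` of an almost contact metric structure on a submanifold of `End(TM)`:
an endomorphism of the tangent bundle, the characteristic vector field and the metric. -/
structure ContactMetricData where
  Phi : ∀ σ : EndBundle M, TangentSpace endModel σ → TangentSpace endModel σ
  chi : ∀ σ : EndBundle M, TangentSpace endModel σ
  h : ∀ σ : EndBundle M, TangentSpace endModel σ → TangentSpace endModel σ → ℝ

/-- The almost contact metric structure `(Φ^{(n)}_±, χ, h_t)` on the twistor space:
`Φ X^h = (φ^σ_± X)^h` and `Φ V = (-1)^{n+1} 𝒥V` with `𝒥V = -σ × V`; `χ_σ = (ξ_σ)^h`;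
`h_t(X^h + V, Y^h + W) = g(X, Y) + t g(V, W)`. -/
def twistorStructure (nabla : Connection M) (t : ℝ) (ε : ℤˣ) (n : ℕ) : ContactMetricData M where
  Phi σ w := horLift nabla σ (phiAt S ε σ.1 σ.2 (dproj σ w))
    + vertLift σ ((-1 : ℝ) ^ (n + 1) • (-crossAt S σ.1 σ.2 (vertPart nabla σ w)))
  chi σ := horLift nabla σ (xiAt S σ.1 σ.2)
  h σ w w' := metric S σ.1 (dproj σ w) (dproj σ w')
    + t * innerAt S σ.1 (vertPart nabla σ w) (vertPart nabla σ w')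

/-- The contact distribution of an almost contact metric structure `C = (Φ, χ, h)` on `𝕋`: the
kernel in `T_σ𝕋` of the contact form `η = h(·, χ)`. -/
def contactDistribution (nabla : Connection M) (C : ContactMetricData M) (σ : EndBundle M) :
    Set (TangentSpace endModel σ) :=
  {w | w ∈ tangentTwistor S nabla σ ∧ C.h σ w (C.chi σ) = 0}

/-! ### The explicit pair of sections -/

/-- The sections `κ₁, κ₂, κ₃` of `Λ²₃TM` defined by an adapted frame. -/
def kappaFrame (e : ∀ q : M, E5 ≃L[ℝ] TangentSpace (𝓡 5) q) (i : Fin 3) (q : M) :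
    TangentSpace (𝓡 5) q →L[ℝ] TangentSpace (𝓡 5) q :=
  conjFrame (e q) (kappa i)

/-- The fibre coordinates `yᵢ(τ) = g(τ, κᵢ) / 5`. -/
def yCoord (e : ∀ q : M, E5 ≃L[ℝ] TangentSpace (𝓡 5) q) (i : Fin 3) (τ : EndBundle M) : ℝ :=
  innerAt S τ.1 τ.2 (kappaFrame e i τ.1) / 5

/-- The vertical vector field `κ̃₁`, `κ̃₁(τ) = κ₁ - ⅕ g(κ₁, τ) τ`. -/
def kappaTilde (e : ∀ q : M, E5 ≃L[ℝ] TangentSpace (𝓡 5) q) (τ : EndBundle M) :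
    TangentSpace endModel τ :=
  vertLift τ (kappaFrame e 0 τ.1 - (innerAt S τ.1 (kappaFrame e 0 τ.1) τ.2 / 5) • τ.2)

/-- The horizontal vector field `A = √3 y₁y₃ E₁^h - (½y₁² + ½y₂² - y₃²) E₃^h`. -/
def fieldA (nabla : Connection M) (e : ∀ q : M, E5 ≃L[ℝ] TangentSpace (𝓡 5) q)
    (τ : EndBundle M) : TangentSpace endModel τ :=
  (√3 * yCoord S e 0 τ * yCoord S e 2 τ) • horLift nabla τ (e τ.1 (stdVec 0))
    - (yCoord S e 0 τ ^ 2 / 2 + yCoord S e 1 τ ^ 2 / 2 - yCoord S e 2 τ ^ 2)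
      • horLift nabla τ (e τ.1 (stdVec 2))

/-- `e` is an adapted frame on a neighbourhood `U` of `p = π(σ)` with `∇E_α = 0` at `p` and
`κ₃ = σ` at `p`. -/
structure IsNormalFrameAt (nabla : Connection M) (σ : EndBundle M) (U : Set M)
    (e : ∀ q : M, E5 ≃L[ℝ] TangentSpace (𝓡 5) q) : Prop where
  adaptedFrame : IsAdaptedFrame S U e
  mem : σ.1 ∈ U
  parallel : ∀ x : E5, nabla (fun q => e q x) σ.1 = 0
  kappa_three : kappaFrame e 2 σ.1 = σ.2

end Manifold

end SO3Twistor

end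

/-!
# The contact distributions of the twistor space are not integrable

In an adapted frame `e` an element of `Λ²₃TM` is a combination `∑ yᵢ κᵢ`, since the eigenspace of
`Υ̂` for the eigenvalue `7` is spanned by `κ₁, κ₂, κ₃` (`mem_Lambda23_iff`). This space is the image
of `𝔰𝔬(3)` under the irreducible representation (`mu_kap`), from which all invariance properties
follow: the vector `ξ` corresponds to the traceless part of the square of a skew-symmetric matrix
(`mu_xiVec`), and its components are the quadratic polynomials `xiVec y`. The contact form on a
vector `w` is the inner product of `dπ w` with `ξ`, so that `κ̃₁`, which is vertical, and `A`, whose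
projection to `M` is orthogonal to `xiVec y`, are sections of the contact distribution
(`kappaTilde_mem`, `fieldA_mem`).

The base point and the expression `exprIn` in the frame are coordinates on `End(TM)`
(`endCoord`), in which a vector `w` has the components `dproj w` and `exprDeriv w`. A horizontal
lift has the components `X` and `[F, ω(X)]`, where `ω` is the connection form (`connForm`,
`IsHorizontalLift.derivs`), and a vertical lift the components `0` and `v`. Hence both fields are
smooth. At a point where the frame is parallel and `κ₃ = σ`, one has `ω = 0`, and only the
derivative of the coefficient `√3 y₁y₃` along `κ₁` contributes to the bracket: it is `√3 E₁^h`
(`mlieBracket_kappaTilde_fieldA`). Since `ξ_σ = -E₁`, this is not in the contact distribution, which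
is therefore not involutive.

Normal frames exist because `SO(3)` acts transitively on the sphere in `Λ²₃`, which gives `κ₃ = σ`
by a constant change of frame, and because the connection form takes values in `Λ²₃`, so that it can
be removed at one point by a gauge transformation `ρ(cay v)`, where `cay` is the Cayley transform
and `dv` at the point is determined by the connection form (`exists_isNormalFrameAt`).

For non-integrability no extension of vector fields along an integral manifold is needed: the
equation saying that the contact form vanishes on the manifold is differentiated once, in the
direction of `κ̃₁` and in that of `A`, and the symmetry of the second derivative leads to the same
non-zero number `√3` (`inner_fderiv_eq_zero`, `not_exists_integral_manifold`).
-/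

noncomputable section

namespace SO3Twistor

set_option linter.unusedSectionVars false

/-! ### The two-vectors of `Λ²₃` -/

lemma stdVec_apply (i j : Fin 5) : stdVec i j = if j = i then 1 else 0 := by
  simp [stdVec]

lemma sum_smul_stdVec (x : E5) : ∑ k, x k • stdVec k = x := by
  ext j; simp [stdVec_apply]

lemma ext_stdVec {F G : E5 →L[ℝ] E5} (h : ∀ i, F (stdVec i) = G (stdVec i)) : F = G := by
  ext1 x
  rw [← sum_smul_stdVec x]
  simp [h]

/-- The element `∑ᵢ yᵢ κᵢ` of `Λ²₃`. -/
def kap (y : Fin 3 → ℝ) : E5 →L[ℝ] E5 := y 0 • kappa 0 + y 1 • kappa 1 + y 2 • kappa 2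

lemma kap_apply (y : Fin 3 → ℝ) (x : E5) : kap y x =
    !₂[-(√3 * y 0 * x 4) - √3 * y 1 * x 2,
       -(y 0 * x 2) - y 1 * x 4 - 2 * y 2 * x 3,
       y 0 * x 1 + √3 * y 1 * x 0 - y 1 * x 3 - y 2 * x 4,
       -(y 0 * x 4) + y 1 * x 2 + 2 * y 2 * x 1,
       √3 * y 0 * x 0 + y 0 * x 3 + y 1 * x 1 + y 2 * x 2] := by
  ext k
  fin_cases k <;> simp [kap, kappa, wedge, stdVec_apply] <;> ring

lemma kappa_eq_kap (i : Fin 3) : kappa i = kap (Pi.single i 1) := by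
  fin_cases i <;> simp [kap] <;> module

lemma kap_add (y z : Fin 3 → ℝ) : kap (y + z) = kap y + kap z := by
  simp only [kap, Pi.add_apply]; module

lemma kap_smul (c : ℝ) (y : Fin 3 → ℝ) : kap (c • y) = c • kap y := by
  simp only [kap, Pi.smul_apply, smul_eq_mul]; module

lemma innerEnd_kap (y z : Fin 3 → ℝ) :
    innerEnd (kap y) (kap z) = 5 * (y 0 * z 0 + y 1 * z 1 + y 2 * z 2) := by
  have h3 : √3 * √3 = 3 := by norm_num
  simp only [innerEnd, kap_apply, Fin.sum_univ_five, PiLp.inner_apply, stdVec_apply]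
  simp
  linear_combination (y 0 * z 0 + y 1 * z 1) * h3

lemma coordY_kap (y : Fin 3 → ℝ) : coordY (kap y) = y := by
  ext i
  rw [coordY, kappa_eq_kap, innerEnd_kap]
  fin_cases i <;> simp

/-! ### The eigenvalue `7` of `Υ̂` -/

lemma upsilonCubic_eq (x : E5) : upsilonCubic x = -x 0 ^ 3 + 3 * x 0 * (x 1 ^ 2 + x 3 ^ 2)
    - 3 / 2 * x 0 * (x 2 ^ 2 + x 4 ^ 2) + 3 * √3 * x 1 * x 2 * x 4
    - 3 * √3 / 2 * x 3 * (x 2 ^ 2 - x 4 ^ 2) := by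
  have h3 : √3 ^ 2 = 3 := by norm_num
  have : ∀ y : ℝ, y / √3 = y * √3 / 3 := by intro y; field_simp; rw [h3]
  simp only [upsilonCubic, mu, Matrix.det_fin_three, this]
  simp
  have h4 : √3 ^ 4 = 9 := by rw [show (4:ℕ) = 2 * 2 by norm_num, pow_mul, h3]; norm_num
  ring_nf
  simp only [h3, h4]
  ring

lemma upsilonEnd_eq (v x : E5) : upsilonEnd v x =
    !₂[-(v 0 * x 0) + v 1 * x 1 + v 3 * x 3 - (v 2 * x 2 + v 4 * x 4) / 2,
       v 0 * x 1 + v 1 * x 0 + √3 / 2 * (v 2 * x 4 + v 4 * x 2),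
       -(v 0 * x 2 + v 2 * x 0) / 2 + √3 / 2 * (v 1 * x 4 + v 4 * x 1)
         - √3 / 2 * (v 3 * x 2 + v 2 * x 3),
       v 0 * x 3 + v 3 * x 0 - √3 / 2 * (v 2 * x 2 - v 4 * x 4),
       -(v 0 * x 4 + v 4 * x 0) / 2 + √3 / 2 * (v 1 * x 2 + v 2 * x 1)
         + √3 / 2 * (v 3 * x 4 + v 4 * x 3)] := by
  ext k
  have h : upsilonEnd v x k = upsilon v x (stdVec k) := by simp [upsilonEnd, stdVec_apply]
  rw [h]
  simp only [upsilon, upsilonCubic_eq, PiLp.add_apply, stdVec_apply]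
  fin_cases k <;> simp <;> ring

/-- The components of `Υ̂(F)`, in a form in which `upsilonEnd_eq` can be inserted. -/
lemma upsilonHat_stdVec (F : E5 →L[ℝ] E5) (i l : Fin 5) : upsilonHat F (stdVec i) l =
    4 * ∑ j, (upsilonEnd (F (stdVec j)) (upsilonEnd (stdVec j) (stdVec i))) l := by
  simp [upsilonHat]

lemma kap_mem_Lambda23 (y : Fin 3 → ℝ) : kap y ∈ Lambda23 := by
  have h3 : √3 ^ 2 = 3 := by norm_num
  intro x
  ext l
  simp only [upsilonHat, upsilonEnd_eq, kap_apply, Fin.sum_univ_five, stdVec_apply]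
  fin_cases l <;> simp <;> ring_nf <;> simp only [h3] <;> ring

set_option linter.unusedSimpArgs false in
/-- The eigenspace of `Υ̂` for the eigenvalue `7` is spanned by `κ₁, κ₂, κ₃`: the linear system
`Υ̂(W) = 7W` for the `25` components of `W` has rank `22` and is solved for all of them but
`W₂₃, W₃₄, W₃₅`. -/
lemma eq_kap_of_mem_Lambda23 {F : E5 →L[ℝ] E5} (hF : F ∈ Lambda23) :
    F = kap ![F (stdVec 1) 2, F (stdVec 2) 3, F (stdVec 2) 4] := by
  have h3 : √3 ^ 2 = 3 := by norm_num
  have hc : √3 ^ 3 = 3 * √3 := by rw [pow_succ, h3]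
  have h : ∀ i l : Fin 5, _ := fun i l =>
    (upsilonHat_stdVec F i l).symm.trans (congrArg (fun v : E5 => v l) (hF (stdVec i)))
  simp [Fin.forall_fin_succ, Fin.sum_univ_five, upsilonEnd_eq, stdVec_apply] at h
  obtain ⟨⟨h00, h01, h02, h03, h04⟩, ⟨h10, h11, h12, h13, h14⟩,
    ⟨h20, h21, h22, h23, h24⟩, ⟨h30, h31, h32, h33, h34⟩,
    ⟨h40, h41, h42, h43, h44⟩⟩ := h
  apply ext_stdVec
  intro i
  ext l
  rw [kap_apply]
  fin_cases i <;> fin_cases l <;> simp [stdVec_apply]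
  · linear_combination (norm := (ring_nf; simp only [h3, hc]; ring))
      (-6 / 35) * h00 + (1 / 35) * h11 + (9 / 70) * h22 + (1 / 35) * h33 + (9 / 70) * h44
  · linear_combination (norm := (ring_nf; simp only [h3, hc]; ring))
      (-2 / 15) * h01 + (-1 / 15) * h10 + (1 / 15) * √3 * h13 + (1 / 15) * √3 * h24
        + (-1 / 15) * √3 * h31
  · linear_combination (norm := (ring_nf; simp only [h3, hc]; ring))
      (-2 / 15) * h02 + (1 / 15) * √3 * h14 + (-4 / 15) * h20 + (1 / 5) * √3 * h23
        + (1 / 15) * √3 * h32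
  · linear_combination (norm := (ring_nf; simp only [h3, hc]; ring))
      (-2 / 15) * h03 + (-1 / 30) * √3 * h22 + (-1 / 15) * h30 + (1 / 30) * √3 * h44
  · linear_combination (norm := (ring_nf; simp only [h3, hc]; ring))
      (-1 / 3) * h04 + (1 / 15) * √3 * h12 + (2 / 15) * √3 * h21 + (-2 / 15) * √3 * h34
        + (2 / 15) * h40
  · linear_combination (norm := (ring_nf; simp only [h3, hc]; ring))
      (-1 / 15) * h01 + (-2 / 15) * h10 + (1 / 15) * √3 * h13 + (1 / 15) * √3 * h24
        + (-1 / 15) * √3 * h31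
  · linear_combination (norm := (ring_nf; simp only [h3, hc]; ring))
      (1 / 35) * h00 + (-6 / 35) * h11 + (13 / 210) * h22 + (17 / 105) * h33 + (13 / 210) * h44
  · linear_combination (norm := (ring_nf; simp only [h3, hc]; ring))
      (-1 / 15) * √3 * h01 + (-1 / 15) * √3 * h10 + (2 / 15) * h13 + (7 / 15) * h24
        + (-7 / 15) * h31
  · linear_combination (norm := (ring_nf; simp only [h3, hc]; ring))
      (-1 / 15) * √3 * h02 + (-2 / 15) * h14 + (1 / 15) * h23 + (1 / 15) * h32
  · linear_combination (norm := (ring_nf; simp only [h3, hc]; ring))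
      (-4 / 15) * h02 + (-2 / 15) * √3 * h14 + (1 / 15) * h20 + (-1 / 5) * √3 * h23
  · linear_combination (norm := (ring_nf; simp only [h3, hc]; ring))
      (1 / 15) * √3 * h04 + (-2 / 15) * h12 + (-1 / 3) * h21 + (1 / 5) * h34 + (-2 / 15) * √3 * h40
  · linear_combination (norm := (ring_nf; simp only [h3, hc]; ring))
      (9 / 70) * h00 + (-1 / 30) * √3 * h03 + (13 / 210) * h11 + (-6 / 35) * h22
        + (-1 / 30) * √3 * h30 + (13 / 210) * h33 + (13 / 210) * h44
  · linear_combination (norm := (ring_nf; simp only [h3, hc]; ring))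
      (-1 / 15) * h03 + (-1 / 30) * √3 * h22 + (-2 / 15) * h30 + (1 / 30) * √3 * h44
  · linear_combination (norm := (ring_nf; simp only [h3, hc]; ring))
      (1 / 15) * √3 * h01 + (1 / 15) * √3 * h10 + (-7 / 15) * h13 + (-7 / 15) * h24 + (2 / 15) * h31
  · linear_combination (norm := (ring_nf; simp only [h3, hc]; ring))
      (-1 / 15) * √3 * h02 + (-1 / 5) * h14 + (2 / 15) * √3 * h20 + (-1 / 3) * h23 + (-2 / 15) * h32
  · linear_combination (norm := (ring_nf; simp only [h3, hc]; ring))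
      (1 / 35) * h00 + (17 / 105) * h11 + (13 / 210) * h22 + (-6 / 35) * h33 + (13 / 210) * h44
  · linear_combination (norm := (ring_nf; simp only [h3, hc]; ring))
      (-2 / 15) * √3 * h04 + (1 / 15) * h12 + (4 / 15) * h21 + (-1 / 3) * h34 + (2 / 15) * √3 * h40
  · linear_combination (norm := (ring_nf; simp only [h3, hc]; ring))
      (-1 / 15) * h04 + (-2 / 15) * √3 * h12 + (-2 / 15) * √3 * h21 + (1 / 15) * √3 * h34
        + (-1 / 3) * h40
  · linear_combination (norm := (ring_nf; simp only [h3, hc]; ring))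
      (-1 / 5) * √3 * h02 + (-1 / 3) * h14 + (1 / 5) * √3 * h20 + (-2 / 5) * h23 + (1 / 15) * h32
  · linear_combination (norm := (ring_nf; simp only [h3, hc]; ring))
      (1 / 15) * √3 * h01 + (1 / 15) * √3 * h10 + (-7 / 15) * h13 + (-7 / 15) * h24 + (7 / 15) * h31
  · linear_combination (norm := (ring_nf; simp only [h3, hc]; ring))
      (-2 / 15) * √3 * h04 + (-1 / 5) * h12 + (1 / 15) * h21 + (-2 / 15) * h34 + (1 / 15) * √3 * h40
  · linear_combination (norm := (ring_nf; simp only [h3, hc]; ring))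
      (9 / 70) * h00 + (1 / 30) * √3 * h03 + (13 / 210) * h11 + (13 / 210) * h22
        + (1 / 30) * √3 * h30 + (13 / 210) * h33 + (-6 / 35) * h44

lemma mem_Lambda23_iff {F : E5 →L[ℝ] E5} : F ∈ Lambda23 ↔ F = kap (coordY F) := by
  refine ⟨fun h => ?_, fun h => h ▸ kap_mem_Lambda23 _⟩
  have := eq_kap_of_mem_Lambda23 h
  rw [this, coordY_kap]

/-! ### Invariance under the irreducible representation -/

lemma mu_add (x y : E5) : mu (x + y) = mu x + mu y := by
  ext i j; fin_cases i <;> fin_cases j <;> simp [mu] <;> ring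

lemma mu_smul (c : ℝ) (x : E5) : mu (c • x) = c • mu x := by
  ext i j; fin_cases i <;> fin_cases j <;> simp [mu] <;> ring

lemma mu_transpose (x : E5) : (mu x)ᵀ = mu x := by
  ext i j; fin_cases i <;> fin_cases j <;> simp [mu]

lemma mu_trace (x : E5) : (mu x).trace = 0 := by
  simp [Matrix.trace_fin_three, mu]; ring

/-- The inverse of `μ` on traceless symmetric matrices. -/
def muInv (X : Matrix (Fin 3) (Fin 3) ℝ) : E5 :=
  !₂[-(√3 / 2) * X 2 2, (X 0 1), X 0 2, (X 1 1 - X 0 0) / 2, X 1 2]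

lemma muInv_mu (x : E5) : muInv (mu x) = x := by
  ext k
  fin_cases k <;> simp [mu, muInv]
  field_simp

lemma mu_injective : Function.Injective mu := Function.LeftInverse.injective muInv_mu

lemma mu_muInv {X : Matrix (Fin 3) (Fin 3) ℝ} (hX : Xᵀ = X) (ht : X.trace = 0) :
    mu (muInv X) = X := by
  have h (i j : Fin 3) : X j i = X i j := congrFun₂ hX i j
  rw [Matrix.trace_fin_three] at ht
  ext i j
  fin_cases i <;> fin_cases j <;> simp [mu, muInv] <;> try exact h _ _
  all_goals field_simp
  all_goals linarith

lemma inner_eq_trace (x y : E5) : inner ℝ x y = (mu x * mu y).trace / 2 := by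
  have h3 : √3 * √3 = 3 := by norm_num
  have : ∀ y : ℝ, y / √3 = y * √3 / 3 := by intro y; field_simp; linear_combination -y * h3
  simp only [PiLp.inner_apply, Fin.sum_univ_five, Matrix.trace_fin_three, mu, this]
  simp [Matrix.mul_apply, Fin.sum_univ_three]
  linear_combination (-x 0 * y 0 / 3) * h3

/-- The skew-symmetric `3 × 3` matrix `a` with `dρ(a) = ∑ᵢ yᵢ κᵢ`, see `mu_kap`. -/
def skewMat (y : Fin 3 → ℝ) : Matrix (Fin 3) (Fin 3) ℝ :=
  !![0, -y 2, -y 1; y 2, 0, -y 0; y 1, y 0, 0]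

lemma exists_eq_skewMat {a : Matrix (Fin 3) (Fin 3) ℝ} (ha : aᵀ = -a) : ∃ y, a = skewMat y := by
  have h (i j : Fin 3) : a j i = -a i j := congrFun₂ ha i j
  refine ⟨![-a 1 2, -a 0 2, -a 0 1], ?_⟩
  ext i j
  have := h i j
  have := h 0 0
  have := h 1 1
  have := h 2 2
  fin_cases i <;> fin_cases j <;> simp [skewMat] <;> simp at * <;> linarith

lemma skewMat_transpose (y : Fin 3 → ℝ) : (skewMat y)ᵀ = -skewMat y := by
  ext i j; fin_cases i <;> fin_cases j <;> simp [skewMat]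

/-- `Λ²₃` is the image of the Lie algebra `𝔰𝔬(3)` under the irreducible representation. -/
lemma mu_kap (y : Fin 3 → ℝ) (x : E5) :
    mu (kap y x) = skewMat y * mu x - mu x * skewMat y := by
  have h3 : √3 ^ 2 = 3 := by norm_num
  have : ∀ y : ℝ, y / √3 = y * √3 / 3 := by intro y; field_simp; linear_combination -y * h3
  ext i j
  fin_cases i <;> fin_cases j <;>
    simp [mu, kap_apply, skewMat, this] <;>
    ring_nf <;> simp only [h3] <;> ring

/-- The vector `ξ_F` for `F = ∑ᵢ yᵢ κᵢ`. -/
def xiVec (y : Fin 3 → ℝ) : E5 :=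
  !₂[(y 0 ^ 2 + y 1 ^ 2 - 2 * y 2 ^ 2) / 2, -(√3 * y 0 * y 1), √3 * y 0 * y 2,
    √3 / 2 * (y 1 ^ 2 - y 0 ^ 2), -(√3 * y 1 * y 2)]

open Equiv.Perm in
lemma xi_kap (y : Fin 3 → ℝ) : xi (kap y) = xiVec y := by
  have e1 : (1 : Fin 5) = Fin.succ 0 := rfl
  have e2 : (2 : Fin 5) = Fin.succ (Fin.succ 0) := rfl
  have e3 : (3 : Fin 5) = Fin.succ (Fin.succ (Fin.succ 0)) := rfl
  have e4 : (4 : Fin 5) = Fin.succ (Fin.succ (Fin.succ (Fin.succ 0))) := rfl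
  ext k
  -- the summand is kept opaque while the sum over the `120` permutations is expanded
  obtain ⟨g, hg⟩ : ∃ g : Fin 5 → Fin 5 → Fin 5 → Fin 5 → Fin 5 → ℝ, ∀ a b c d e, g a b c d e =
    1 / 16 * entry (kap y) b c * entry (kap y) d e * stdVec a k := ⟨_, fun _ _ _ _ _ => rfl⟩
  have h : xi (kap y) k = ∑ s : Equiv.Perm (Fin 5),
      ((Equiv.Perm.sign s : ℤ) : ℝ) * g (s 0) (s 1) (s 2) (s 3) (s 4) := by
    simp only [xi, WithLp.ofLp_sum, Finset.sum_apply, PiLp.smul_apply, smul_eq_mul, hg]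
    exact Finset.sum_congr rfl fun s _ => by ring
  rw [h]
  simp only [Finset.univ_perm_fin_succ, ← Finset.univ_product_univ, Finset.sum_map,
    Finset.sum_product, Equiv.coe_toEmbedding, decomposeFin.symm_sign, Finset.univ_unique,
    Finset.sum_singleton, e1, e2, e3, e4, decomposeFin_symm_apply_succ,
    decomposeFin_symm_apply_zero]
  simp [Fin.sum_univ_succ]
  simp [Equiv.swap_apply_def]
  simp only [hg, entry, kap_apply, stdVec_apply, xiVec]
  fin_cases k <;> simp <;> ring_nf

/-- `μ(ξ_F)` is up to a factor the traceless part of `a²`, `a` being the matrix of `F`. This makes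
the equivariance of `ξ` evident. -/
lemma mu_xiVec (y : Fin 3 → ℝ) : mu (xiVec y) = √3 • (skewMat y * skewMat y
    - ((skewMat y * skewMat y).trace / 3) • (1 : Matrix (Fin 3) (Fin 3) ℝ)) := by
  have h3 : √3 ^ 2 = 3 := by norm_num
  have : ∀ y : ℝ, y / √3 = y * √3 / 3 := by intro y; field_simp; linear_combination -y * h3
  ext i j
  fin_cases i <;> fin_cases j <;>
    simp [mu, xiVec, skewMat, Matrix.trace_fin_three, this] <;>
    ring

/-! ### The representation of `SO(3)` on `ℝ⁵` -/

lemma mem_SO3_iff {h : Matrix (Fin 3) (Fin 3) ℝ} :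
    h ∈ Matrix.specialOrthogonalGroup (Fin 3) ℝ ↔ h * hᵀ = 1 ∧ h.det = 1 := by
  rw [Matrix.mem_specialOrthogonalGroup_iff, Matrix.mem_orthogonalGroup_iff]

lemma transpose_mul_of_mem_SO3 {h : Matrix (Fin 3) (Fin 3) ℝ}
    (hh : h ∈ Matrix.specialOrthogonalGroup (Fin 3) ℝ) : hᵀ * h = 1 :=
  mul_eq_one_comm.mp (mem_SO3_iff.mp hh).1

lemma transpose_mem_SO3 {h : Matrix (Fin 3) (Fin 3) ℝ}
    (hh : h ∈ Matrix.specialOrthogonalGroup (Fin 3) ℝ) :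
    hᵀ ∈ Matrix.specialOrthogonalGroup (Fin 3) ℝ := by
  rw [mem_SO3_iff, Matrix.transpose_transpose, Matrix.det_transpose]
  exact ⟨transpose_mul_of_mem_SO3 hh, (mem_SO3_iff.mp hh).2⟩

/-- The linear map `ρ(h)`, as a function. -/
def rhoFun (h : Matrix (Fin 3) (Fin 3) ℝ) (x : E5) : E5 := muInv (h * mu x * hᵀ)

lemma mu_rhoFun {h : Matrix (Fin 3) (Fin 3) ℝ}
    (hh : h ∈ Matrix.specialOrthogonalGroup (Fin 3) ℝ) (x : E5) :
    mu (rhoFun h x) = h * mu x * hᵀ := by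
  apply mu_muInv
  · simp only [Matrix.transpose_mul, Matrix.transpose_transpose, mu_transpose, mul_assoc]
  · rw [Matrix.trace_mul_cycle, transpose_mul_of_mem_SO3 hh, one_mul, mu_trace]

lemma rhoFun_rhoFun_transpose {h : Matrix (Fin 3) (Fin 3) ℝ}
    (hh : h ∈ Matrix.specialOrthogonalGroup (Fin 3) ℝ) (x : E5) :
    rhoFun hᵀ (rhoFun h x) = x := by
  apply mu_injective
  rw [mu_rhoFun (transpose_mem_SO3 hh), mu_rhoFun hh, Matrix.transpose_transpose]
  calc hᵀ * (h * mu x * hᵀ) * h = (hᵀ * h) * mu x * (hᵀ * h) := by simp only [mul_assoc]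
    _ = mu x := by simp [transpose_mul_of_mem_SO3 hh]

/-- The automorphism `ρ(h)` of `ℝ⁵`. -/
def rho (h : Matrix (Fin 3) (Fin 3) ℝ) (hh : h ∈ Matrix.specialOrthogonalGroup (Fin 3) ℝ) :
    E5 ≃L[ℝ] E5 :=
  LinearEquiv.toContinuousLinearEquiv
    { toFun := rhoFun h
      invFun := rhoFun hᵀ
      map_add' := fun x y => mu_injective <| by
        simp only [mu_add, mu_rhoFun hh, mul_add, add_mul]
      map_smul' := fun c x => mu_injective <| by
        simp [mu_smul, mu_rhoFun hh]
      left_inv := rhoFun_rhoFun_transpose hh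
      right_inv := fun x => by
        have := rhoFun_rhoFun_transpose (transpose_mem_SO3 hh) x
        rwa [Matrix.transpose_transpose] at this }

lemma rho_apply (h : Matrix (Fin 3) (Fin 3) ℝ)
    (hh : h ∈ Matrix.specialOrthogonalGroup (Fin 3) ℝ) (x : E5) : rho h hh x = rhoFun h x := rfl

lemma rho_mem (h : Matrix (Fin 3) (Fin 3) ℝ)
    (hh : h ∈ Matrix.specialOrthogonalGroup (Fin 3) ℝ) : rho h hh ∈ irrSO3 :=
  ⟨h, hh, mu_rhoFun hh⟩

lemma inner_irrSO3 {T : E5 ≃L[ℝ] E5} (hT : T ∈ irrSO3) (x y : E5) :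
    inner ℝ (T x) (T y) = inner ℝ x y := by
  obtain ⟨h, hh, H⟩ := hT
  have h1 := transpose_mul_of_mem_SO3 hh
  have : mu (T x) * mu (T y) = h * (mu x * mu y) * hᵀ := by
    rw [H, H]
    calc _ = h * mu x * (hᵀ * h) * mu y * hᵀ := by simp only [mul_assoc]
      _ = _ := by rw [h1]; simp only [mul_assoc, one_mul]
  rw [inner_eq_trace, inner_eq_trace, this, Matrix.trace_mul_cycle, h1, one_mul]

/-- `ι(SO(3))` acts on `Λ²₃`, and `F ↦ ξ_F` is equivariant. -/
lemma exists_kap_conj {T : E5 ≃L[ℝ] E5} (hT : T ∈ irrSO3) (y : Fin 3 → ℝ) :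
    ∃ z, (∀ x, T (kap y x) = kap z (T x)) ∧ T (xiVec y) = xiVec z := by
  obtain ⟨h, hh, H⟩ := hT
  have h1 := transpose_mul_of_mem_SO3 hh
  have h2 := (mem_SO3_iff.mp hh).1
  obtain ⟨z, hz⟩ : ∃ z, h * skewMat y * hᵀ = skewMat z := by
    apply exists_eq_skewMat
    simp only [Matrix.transpose_mul, Matrix.transpose_transpose, skewMat_transpose, mul_assoc,
      neg_mul, mul_neg]
  have comm (A B : Matrix (Fin 3) (Fin 3) ℝ) : h * (A * B) * hᵀ = (h * A * hᵀ) * (h * B * hᵀ) := by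
    calc _ = h * A * 1 * B * hᵀ := by simp only [mul_assoc, one_mul]
      _ = _ := by rw [← h1]; simp only [mul_assoc]
  refine ⟨z, fun x => mu_injective ?_, mu_injective ?_⟩
  · rw [H, mu_kap, mu_kap, H, ← hz, mul_sub, sub_mul, comm, comm]
  · rw [H, mu_xiVec, mu_xiVec, ← hz, ← comm, Matrix.trace_mul_cycle, h1, one_mul]
    simp only [Matrix.mul_smul, Matrix.smul_mul, mul_sub, sub_mul, mul_one, h2]

/-! ### Some rotations -/

/-- The Cayley transform of the skew-symmetric matrix `a = skewMat y`, the rotation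
`(1 - a)⁻¹ (1 + a) = 1 + 2 (a + a²) / (1 + |y|²)`. -/
def cay (y : Fin 3 → ℝ) : Matrix (Fin 3) (Fin 3) ℝ :=
  1 + (2 / (1 + y 0 ^ 2 + y 1 ^ 2 + y 2 ^ 2)) • (skewMat y + skewMat y * skewMat y)

lemma cay_mem (y : Fin 3 → ℝ) : cay y ∈ Matrix.specialOrthogonalGroup (Fin 3) ℝ := by
  rw [mem_SO3_iff]
  have hN : 1 + y 0 ^ 2 + y 1 ^ 2 + y 2 ^ 2 ≠ 0 := by positivity
  constructor
  · ext i j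
    fin_cases i <;> fin_cases j <;>
      simp [cay, skewMat, Matrix.mul_apply, Fin.sum_univ_three] <;> field_simp <;> ring
  · simp [cay, skewMat, Matrix.det_fin_three]
    field_simp
    ring

lemma cay_zero : cay 0 = 1 := by
  have : skewMat 0 = 0 := by ext i j; fin_cases i <;> fin_cases j <;> simp [skewMat]
  simp [cay, this]

/-- `SO(3)` acts transitively on the unit sphere. -/
lemma exists_conj_skewMat_eq {y : Fin 3 → ℝ} (hy : y 0 ^ 2 + y 1 ^ 2 + y 2 ^ 2 = 1) :
    ∃ h ∈ Matrix.specialOrthogonalGroup (Fin 3) ℝ, h * skewMat ![0, 0, 1] * hᵀ = skewMat y := by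
  suffices ∃ h ∈ Matrix.specialOrthogonalGroup (Fin 3) ℝ,
      h * skewMat ![0, 0, 1] = skewMat y * h by
    obtain ⟨h, hh, H⟩ := this
    exact ⟨h, hh, by rw [H, mul_assoc, (mem_SO3_iff.mp hh).1, mul_one]⟩
  by_cases h2 : 1 + y 2 = 0
  · have e2 : y 2 = -1 := by linarith
    have e0 : y 0 = 0 := by nlinarith [sq_nonneg (y 0), sq_nonneg (y 1)]
    have e1 : y 1 = 0 := by nlinarith [sq_nonneg (y 0), sq_nonneg (y 1)]
    refine ⟨!![1, 0, 0; 0, -1, 0; 0, 0, -1], mem_SO3_iff.mpr ⟨?_, ?_⟩, ?_⟩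
    · ext i j
      fin_cases i <;> fin_cases j <;> simp [Matrix.mul_apply, Fin.sum_univ_three]
    · simp [Matrix.det_fin_three]
    · ext i j
      fin_cases i <;> fin_cases j <;> simp [skewMat, e0, e1, e2]
  · -- the rotation in the plane of the two vectors
    have hN : 2 / (1 + (y 1 / (1 + y 2)) ^ 2 + (-y 0 / (1 + y 2)) ^ 2 + 0 ^ 2) = 1 + y 2 := by
      rw [div_eq_iff (by positivity)]
      field_simp
      linear_combination -hy
    refine ⟨cay ![y 1 / (1 + y 2), -y 0 / (1 + y 2), 0], cay_mem _, ?_⟩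
    have e : cay ![y 1 / (1 + y 2), -y 0 / (1 + y 2), 0] = 1 + (1 + y 2) •
        (skewMat ![y 1 / (1 + y 2), -y 0 / (1 + y 2), 0]
          + skewMat ![y 1 / (1 + y 2), -y 0 / (1 + y 2), 0]
            * skewMat ![y 1 / (1 + y 2), -y 0 / (1 + y 2), 0]) := by
      change 1 + (2 / (1 + (y 1 / (1 + y 2)) ^ 2 + (-y 0 / (1 + y 2)) ^ 2 + 0 ^ 2)) • _ = _
      rw [hN]
    rw [e]
    ext i j
    fin_cases i <;> fin_cases j <;>
      simp [skewMat, Matrix.mul_apply, Fin.sum_univ_three] <;> field_simp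
    all_goals first
      | ring1
      | linear_combination hy
      | linear_combination -hy
      | linear_combination -y 0 * hy
      | linear_combination -y 1 * hy

/-! ### The differential of the Cayley transform -/

lemma muInv_add (X Y : Matrix (Fin 3) (Fin 3) ℝ) : muInv (X + Y) = muInv X + muInv Y := by
  ext k; fin_cases k <;> simp [muInv] <;> ring

lemma muInv_smul (c : ℝ) (X : Matrix (Fin 3) (Fin 3) ℝ) : muInv (c • X) = c • muInv X := by
  ext k; fin_cases k <;> simp [muInv] <;> ring

lemma contDiff_rhoFun_cay (x : E5) : ContDiff ℝ ∞ (fun y : Fin 3 → ℝ => rhoFun (cay y) x) := by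
  have hN (y : Fin 3 → ℝ) : 1 + y 0 ^ 2 + y 1 ^ 2 + y 2 ^ 2 ≠ 0 := by positivity
  have hs (i j : Fin 3) : ContDiff ℝ ∞ (fun y : Fin 3 → ℝ => skewMat y i j) := by
    fin_cases i <;> fin_cases j <;> simp [skewMat] <;> fun_prop
  have hc (i j : Fin 3) : ContDiff ℝ ∞ (fun y : Fin 3 → ℝ => cay y i j) := by
    simp only [cay, Matrix.add_apply, Matrix.smul_apply, Matrix.mul_apply, Fin.sum_univ_three,
      smul_eq_mul]
    have hd : ContDiff ℝ ∞ (fun y : Fin 3 → ℝ => 1 + y 0 ^ 2 + y 1 ^ 2 + y 2 ^ 2) := by fun_prop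
    exact contDiff_const.add ((contDiff_const.div hd hN).mul ((hs i j).add
      ((((hs i 0).mul (hs 0 j)).add ((hs i 1).mul (hs 1 j))).add ((hs i 2).mul (hs 2 j)))))
  have hX (i j : Fin 3) : ContDiff ℝ ∞ (fun y : Fin 3 → ℝ => (cay y * mu x * (cay y)ᵀ) i j) := by
    simp only [Matrix.mul_apply, Matrix.transpose_apply]
    exact ContDiff.sum fun l _ => (ContDiff.sum fun k _ => (hc i k).mul contDiff_const).mul (hc j l)
  rw [contDiff_euclidean]
  intro k
  fin_cases k <;> simp only [rhoFun, muInv]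
  · exact contDiff_const.mul (hX 2 2)
  · exact hX 0 1
  · exact hX 0 2
  · exact ((hX 1 1).sub (hX 0 0)).div_const 2
  · exact hX 1 2

/-- The differential of `y ↦ ρ(cay y)` at the origin. -/
lemma fderiv_rhoFun_cay (x : E5) (w : Fin 3 → ℝ) :
    fderiv ℝ (fun y : Fin 3 → ℝ => rhoFun (cay y) x) 0 w = (2 : ℝ) • kap w x := by
  have hdiff : DifferentiableAt ℝ (fun y : Fin 3 → ℝ => rhoFun (cay y) x) ((0 : ℝ) • w) :=
    (contDiff_rhoFun_cay x).differentiable (by simp) _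
  have hline : HasDerivAt (fun t : ℝ => t • w) w 0 := by
    simpa using (hasDerivAt_id (0 : ℝ)).smul_const w
  have h1 := hdiff.hasFDerivAt.comp_hasDerivAt (0 : ℝ) hline
  set s := w 0 ^ 2 + w 1 ^ 2 + w 2 ^ 2 with hs
  set a := skewMat w with ha
  have hskew (t : ℝ) : skewMat (t • w) = t • a := by
    ext i j; fin_cases i <;> fin_cases j <;> simp [skewMat, ha]
  have hα : HasDerivAt (fun t : ℝ => 2 * t / (1 + s * t ^ 2)) 2 0 := by
    have := ((hasDerivAt_id' (0 : ℝ)).const_mul 2).fun_div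
      (((hasDerivAt_pow 2 (0 : ℝ)).const_mul s).const_add 1) (by simp)
    simpa using this
  have hβ : HasDerivAt (fun t : ℝ => t * (2 * t / (1 + s * t ^ 2))) 0 0 := by
    simpa using (hasDerivAt_id' (0 : ℝ)).fun_mul hα
  have hcay (t : ℝ) : cay (t • w) = 1 + (2 * t / (1 + s * t ^ 2)) • a
      + (t * (2 * t / (1 + s * t ^ 2))) • (a * a) := by
    have : 1 + (t • w) 0 ^ 2 + (t • w) 1 ^ 2 + (t • w) 2 ^ 2 = 1 + s * t ^ 2 := by
      simp [hs]; ring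
    rw [cay, this, hskew]
    simp only [smul_add, Matrix.smul_mul, Matrix.mul_smul, smul_smul, add_assoc]
    congr 3 <;> ring
  -- with `cay (t w) = 1 + α a + β a²`, all terms but `α • kap w x` are of order `t²`
  have hexp (t : ℝ) (α β : ℝ) (hα : cay (t • w) = 1 + α • a + β • (a * a)) :
      rhoFun (cay (t • w)) x = x + α • kap w x + (α * α) • muInv (-(a * mu x * a))
        + β • muInv (a * a * mu x + mu x * (a * a))
        + (α * β) • muInv (a * mu x * (a * a) - a * a * mu x * a)
        + (β * β) • muInv (a * a * mu x * (a * a)) := by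
    have haT : aᵀ = -a := skewMat_transpose w
    have hk : kap w x = muInv (a * mu x - mu x * a) := by rw [ha, ← mu_kap, muInv_mu]
    rw [hk]
    nth_rewrite 2 [← muInv_mu x]
    simp only [← muInv_smul, ← muInv_add, rhoFun, hα]
    congr 1
    simp only [Matrix.transpose_add, Matrix.transpose_smul, Matrix.transpose_mul, haT,
      Matrix.transpose_one]
    simp only [mul_add, add_mul, mul_one, one_mul, Matrix.smul_mul, Matrix.mul_smul, mul_neg,
      neg_mul, neg_neg, smul_add, smul_sub, smul_neg, smul_smul, mul_assoc, mul_comm β α]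
    abel
  have h2 : HasDerivAt (fun t : ℝ => rhoFun (cay (t • w)) x) ((2 : ℝ) • kap w x) 0 := by
    have := fun t => hexp t _ _ (hcay t)
    simp only [this]
    have := (((((hα.smul_const (kap w x)).const_add x).fun_add
      ((hα.fun_mul hα).smul_const (muInv (-(a * mu x * a))))).fun_add
      (hβ.smul_const (muInv (a * a * mu x + mu x * (a * a))))).fun_add
      ((hα.fun_mul hβ).smul_const (muInv (a * mu x * (a * a) - a * a * mu x * a)))).fun_add
      ((hβ.fun_mul hβ).smul_const (muInv (a * a * mu x * (a * a))))
    simpa using this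
  have := h1.unique h2
  simpa using this

/-! ### Tensors in an adapted frame -/

lemma innerEnd_eq_trace (F G : E5 →L[ℝ] E5) {ι : Type*} [Fintype ι] (b : OrthonormalBasis ι ℝ E5) :
    (1 / 2) * ∑ j, inner ℝ (F (b j)) (G (b j)) =
      (1 / 2) * LinearMap.trace ℝ E5 (F.adjoint ∘L G : E5 →L[ℝ] E5) := by
  rw [LinearMap.trace_eq_sum_inner _ b]
  simp [ContinuousLinearMap.adjoint_inner_right]

lemma innerEnd_conj {T : E5 ≃L[ℝ] E5} (hT : ∀ x y, inner ℝ (T x) (T y) = inner ℝ x y)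
    (F G : E5 →L[ℝ] E5) :
    innerEnd ((T : E5 →L[ℝ] E5) ∘L F ∘L (T.symm : E5 →L[ℝ] E5))
      ((T : E5 →L[ℝ] E5) ∘L G ∘L (T.symm : E5 →L[ℝ] E5)) = innerEnd F G := by
  have hs : ∀ x y, inner ℝ (T.symm x) (T.symm y) = inner ℝ x y := fun x y => by
    rw [← hT, T.apply_symm_apply, T.apply_symm_apply]
  let b := (EuclideanSpace.basisFun (Fin 5) ℝ).map (T.symm.toLinearEquiv.isometryOfInner hs)
  have hb (j : Fin 5) : b j = T.symm (stdVec j) := by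
    simp [b, stdVec]
  have h1 := innerEnd_eq_trace F G b
  have h2 := innerEnd_eq_trace F G (EuclideanSpace.basisFun (Fin 5) ℝ)
  rw [← h2] at h1
  simp only [hb, EuclideanSpace.basisFun_apply] at h1
  simpa [innerEnd, hT, stdVec] using h1

section Manifold

variable {M : Type*} [TopologicalSpace M] [ChartedSpace E5 M] [IsManifold (𝓡 5) ∞ M]

/-- The expression of an endomorphism of `T_pM` in the frame `u`. -/
def exprIn {p : M} (u : E5 ≃L[ℝ] TangentSpace (𝓡 5) p)
    (F : TangentSpace (𝓡 5) p →L[ℝ] TangentSpace (𝓡 5) p) : E5 →L[ℝ] E5 :=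
  (u.symm : TangentSpace (𝓡 5) p →L[ℝ] E5) ∘L F ∘L (u : E5 →L[ℝ] TangentSpace (𝓡 5) p)

lemma exprIn_apply {p : M} (u : E5 ≃L[ℝ] TangentSpace (𝓡 5) p)
    (F : TangentSpace (𝓡 5) p →L[ℝ] TangentSpace (𝓡 5) p) (x : E5) :
    exprIn u F x = u.symm (F (u x)) := rfl

lemma conjFrame_apply {p : M} (u : E5 ≃L[ℝ] TangentSpace (𝓡 5) p) (F : E5 →L[ℝ] E5)
    (X : TangentSpace (𝓡 5) p) : conjFrame u F X = u (F (u.symm X)) := rfl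

lemma exprIn_conjFrame {p : M} (u : E5 ≃L[ℝ] TangentSpace (𝓡 5) p) (F : E5 →L[ℝ] E5) :
    exprIn u (conjFrame u F) = F := by
  ext1 x; simp [exprIn_apply, conjFrame_apply]

lemma conjFrame_exprIn {p : M} (u : E5 ≃L[ℝ] TangentSpace (𝓡 5) p)
    (F : TangentSpace (𝓡 5) p →L[ℝ] TangentSpace (𝓡 5) p) : conjFrame u (exprIn u F) = F := by
  ext1 x; simp [exprIn_apply, conjFrame_apply]

lemma exprIn_add {p : M} (u : E5 ≃L[ℝ] TangentSpace (𝓡 5) p)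
    (F G : TangentSpace (𝓡 5) p →L[ℝ] TangentSpace (𝓡 5) p) :
    exprIn u (F + G) = exprIn u F + exprIn u G := by
  ext1 x; simp [exprIn_apply]

lemma exprIn_smul {p : M} (u : E5 ≃L[ℝ] TangentSpace (𝓡 5) p) (c : ℝ)
    (F : TangentSpace (𝓡 5) p →L[ℝ] TangentSpace (𝓡 5) p) :
    exprIn u (c • F) = c • exprIn u F := by
  ext1 x; simp [exprIn_apply]

lemma exprIn_sub {p : M} (u : E5 ≃L[ℝ] TangentSpace (𝓡 5) p)
    (F G : TangentSpace (𝓡 5) p →L[ℝ] TangentSpace (𝓡 5) p) :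
    exprIn u (F - G) = exprIn u F - exprIn u G := by
  ext1 x; simp [exprIn_apply]

variable {S : IrreducibleSO3Structure M} {p : M} {u v : E5 ≃L[ℝ] TangentSpace (𝓡 5) p}

lemma exists_change (hu : u ∈ S.adapted p) (hv : v ∈ S.adapted p) :
    ∃ T ∈ irrSO3, ∀ x, v x = u (T x) :=
  (S.mem_adapted_iff p u hu v).mp hv

lemma exprIn_change {T : E5 ≃L[ℝ] E5} (hT : ∀ x, v x = u (T x))
    (F : TangentSpace (𝓡 5) p →L[ℝ] TangentSpace (𝓡 5) p) :
    exprIn u F = (T : E5 →L[ℝ] E5) ∘L exprIn v F ∘L (T.symm : E5 →L[ℝ] E5) := by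
  have hs (X) : u.symm X = T (v.symm X) := by
    rw [ContinuousLinearEquiv.symm_apply_eq, ← hT, v.apply_symm_apply]
  ext1 x
  simp [exprIn_apply, hT, hs]

/-- A change of the adapted frame preserves `Λ²₃`, and the vector `ξ` does not depend on
the frame. -/
lemma exprIn_eq_kap (hu : u ∈ S.adapted p) (hv : v ∈ S.adapted p)
    {F : TangentSpace (𝓡 5) p →L[ℝ] TangentSpace (𝓡 5) p} {y : Fin 3 → ℝ}
    (hF : exprIn v F = kap y) : ∃ z, exprIn u F = kap z ∧ v (xiVec y) = u (xiVec z) := by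
  obtain ⟨T, hT, h⟩ := exists_change hu hv
  obtain ⟨z, hz, hξ⟩ := exists_kap_conj hT y
  refine ⟨z, ?_, by rw [h, hξ]⟩
  rw [exprIn_change h, hF]
  ext1 x
  simp [hz]

lemma someFrame_mem (S : IrreducibleSO3Structure M) (p : M) : someFrame S p ∈ S.adapted p :=
  (adapted_nonempty S p).some_mem

/-- The metric may be computed in any adapted frame. -/
lemma metric_eq (hu : u ∈ S.adapted p) (X Y : TangentSpace (𝓡 5) p) :
    metric S p X Y = inner ℝ (u.symm X) (u.symm Y) := by
  obtain ⟨T, hT, h⟩ := exists_change hu (someFrame_mem S p)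
  have hs (X) : u.symm X = T ((someFrame S p).symm X) := by
    rw [ContinuousLinearEquiv.symm_apply_eq, ← h, ContinuousLinearEquiv.apply_symm_apply]
  rw [metric, hs, hs, inner_irrSO3 hT]

lemma innerAt_eq (hu : u ∈ S.adapted p)
    (F G : TangentSpace (𝓡 5) p →L[ℝ] TangentSpace (𝓡 5) p) :
    innerAt S p F G = innerEnd (exprIn u F) (exprIn u G) := by
  obtain ⟨T, hT, h⟩ := exists_change hu (someFrame_mem S p)
  rw [exprIn_change h, exprIn_change h, innerEnd_conj (inner_irrSO3 hT)]
  rfl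

lemma mem_Lambda23At_iff (hu : u ∈ S.adapted p)
    {F : TangentSpace (𝓡 5) p →L[ℝ] TangentSpace (𝓡 5) p} :
    F ∈ Lambda23At S p ↔ exprIn u F ∈ Lambda23 := by
  constructor
  · intro h
    obtain ⟨z, hz, -⟩ := exprIn_eq_kap hu (someFrame_mem S p) (mem_Lambda23_iff.mp h)
    exact hz ▸ kap_mem_Lambda23 z
  · intro h
    obtain ⟨z, hz, -⟩ := exprIn_eq_kap (someFrame_mem S p) hu (mem_Lambda23_iff.mp h)
    change exprIn (someFrame S p) F ∈ Lambda23
    exact hz ▸ kap_mem_Lambda23 z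

lemma xiAt_eq (hu : u ∈ S.adapted p)
    {F : TangentSpace (𝓡 5) p →L[ℝ] TangentSpace (𝓡 5) p} (hF : F ∈ Lambda23At S p) :
    xiAt S p F = u (xiVec (coordY (exprIn u F))) := by
  have h : exprIn (someFrame S p) F = kap (coordY (exprIn (someFrame S p) F)) :=
    mem_Lambda23_iff.mp hF
  obtain ⟨z, hz, hξ⟩ := exprIn_eq_kap hu (someFrame_mem S p) h
  rw [hz, coordY_kap, ← hξ, ← xi_kap, ← h]
  rfl

/-! ### Smoothness of frames -/

variable {EN : Type*} [NormedAddCommGroup EN] [NormedSpace ℝ EN] {HN : Type*} [TopologicalSpace HN]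
  {J : ModelWithCorners ℝ EN HN} {N : Type*} [TopologicalSpace N] [ChartedSpace HN N]

lemma clm_eq_sum (F : E5 →L[ℝ] E5) :
    F = ∑ k, (EuclideanSpace.proj k : E5 →L[ℝ] ℝ).smulRight (F (stdVec k)) := by
  apply ext_stdVec
  intro i
  simp [stdVec_apply]

/-- A map into `End(ℝ⁵)` is smooth if its value on each vector is. -/
lemma contMDiffAt_clm {g : N → E5 →L[ℝ] E5} {m : N}
    (h : ∀ x, ContMDiffAt J 𝓘(ℝ, E5) ∞ (fun n => g n x) m) :
    ContMDiffAt J 𝓘(ℝ, E5 →L[ℝ] E5) ∞ g m := by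
  have : g = fun n => ∑ k, ContinuousLinearMap.smulRightL ℝ E5 E5
      (EuclideanSpace.proj k : E5 →L[ℝ] ℝ) (g n (stdVec k)) := by
    ext1 n
    exact clm_eq_sum (g n)
  rw [this]
  exact ContMDiffAt.sum fun k _ =>
    (ContinuousLinearMap.contMDiff _).contMDiffAt.comp m (h (stdVec k))

/-- The matrix of the frame `e` in the trivialization of `TM` at `p`. -/
def frameMat (p : M) (e : ∀ q : M, E5 ≃L[ℝ] TangentSpace (𝓡 5) q) (q : M) : E5 →L[ℝ] E5 :=
  (trivializationAt E5 (TangentSpace (𝓡 5) : M → Type _) p).continuousLinearMapAt ℝ q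
    ∘L (e q : E5 →L[ℝ] TangentSpace (𝓡 5) q)

/-- The inverse of `frameMat`. -/
def frameMatInv (p : M) (e : ∀ q : M, E5 ≃L[ℝ] TangentSpace (𝓡 5) q) (q : M) : E5 →L[ℝ] E5 :=
  ((e q).symm : TangentSpace (𝓡 5) q →L[ℝ] E5)
    ∘L (trivializationAt E5 (TangentSpace (𝓡 5) : M → Type _) p).symmL ℝ q

variable {U : Set M} {e : ∀ q : M, E5 ≃L[ℝ] TangentSpace (𝓡 5) q} {q : M}

lemma baseSet_mem_nhds (p : M) :
    (trivializationAt E5 (TangentSpace (𝓡 5) : M → Type _) p).baseSet ∈ 𝓝 p :=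
  (trivializationAt E5 (TangentSpace (𝓡 5) : M → Type _) p).open_baseSet.mem_nhds
    (FiberBundle.mem_baseSet_trivializationAt' p)

lemma frameMatInv_frameMat
    (hq : q ∈ (trivializationAt E5 (TangentSpace (𝓡 5) : M → Type _) p).baseSet) (x : E5) :
    frameMatInv p e q (frameMat p e q x) = x := by
  change (e q).symm (Trivialization.symmL ℝ _ q (Trivialization.continuousLinearMapAt ℝ _ q _)) = x
  rw [Trivialization.symmL_continuousLinearMapAt _ hq]
  exact (e q).symm_apply_apply x

lemma frameMat_frameMatInv
    (hq : q ∈ (trivializationAt E5 (TangentSpace (𝓡 5) : M → Type _) p).baseSet) (x : E5) :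
    frameMat p e q (frameMatInv p e q x) = x := by
  change Trivialization.continuousLinearMapAt ℝ _ q
    (e q ((e q).symm (Trivialization.symmL ℝ _ q x))) = x
  rw [(e q).apply_symm_apply, Trivialization.continuousLinearMapAt_symmL _ hq]

lemma contMDiffAt_frameMat
    (he : ∀ x, ContMDiffAt (𝓡 5) (𝓡 5).tangent ∞ (frameField e x) p) :
    ContMDiffAt (𝓡 5) 𝓘(ℝ, E5 →L[ℝ] E5) ∞ (frameMat p e) p := by
  refine contMDiffAt_clm fun x => ?_
  refine ((contMDiffAt_section (F := E5) (E := (TangentSpace (𝓡 5) : M → Type _)) p).mp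
    (he x)).congr_of_eventuallyEq ?_
  filter_upwards [baseSet_mem_nhds p] with q hq
  exact congrFun (Trivialization.coe_linearMapAt_of_mem _ hq) (e q x)

lemma contMDiffAt_frameMatInv
    (he : ∀ x, ContMDiffAt (𝓡 5) (𝓡 5).tangent ∞ (frameField e x) p) :
    ContMDiffAt (𝓡 5) 𝓘(ℝ, E5 →L[ℝ] E5) ∞ (frameMatInv p e) p := by
  have hinv {q : M} (hq : q ∈ (trivializationAt E5 (TangentSpace (𝓡 5) : M → Type _) p).baseSet) :
      ∃ A : E5 ≃L[ℝ] E5, (A : E5 →L[ℝ] E5) = frameMat p e q ∧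
        (A.symm : E5 →L[ℝ] E5) = frameMatInv p e q :=
    ⟨ContinuousLinearEquiv.equivOfInverse _ _ (frameMatInv_frameMat hq) (frameMat_frameMatInv hq),
      rfl, rfl⟩
  have h : ContMDiffAt (𝓡 5) 𝓘(ℝ, E5 →L[ℝ] E5) ∞
      (fun q => ContinuousLinearMap.inverse (frameMat p e q)) p := by
    obtain ⟨A, hA, -⟩ := hinv (FiberBundle.mem_baseSet_trivializationAt' p)
    have := contDiffAt_map_inverse (n := ∞) (𝕜 := ℝ) A
    rw [hA] at this
    exact this.contMDiffAt.comp p (contMDiffAt_frameMat he)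
  refine h.congr_of_eventuallyEq ?_
  filter_upwards [baseSet_mem_nhds p] with q hq
  obtain ⟨A, hA, hA'⟩ := hinv hq
  rw [← hA, ← hA', ContinuousLinearMap.inverse_equiv]

end Manifold

section Manifold

variable {M : Type*} [TopologicalSpace M] [ChartedSpace E5 M] [IsManifold (𝓡 5) ∞ M]
  {p : M} {e : ∀ q : M, E5 ≃L[ℝ] TangentSpace (𝓡 5) q}
  {EN : Type*} [NormedAddCommGroup EN] [NormedSpace ℝ EN] {HN : Type*} [TopologicalSpace HN]
  {J : ModelWithCorners ℝ EN HN} {N : Type*} [TopologicalSpace N] [ChartedSpace HN N]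
  {b : N → M} {m : N}

lemma frame_symm_eq {p q : M}
    (hq : q ∈ (trivializationAt E5 (TangentSpace (𝓡 5) : M → Type _) p).baseSet)
    (Y : TangentSpace (𝓡 5) q) : (e q).symm Y = frameMatInv p e q
      ((trivializationAt E5 (TangentSpace (𝓡 5) : M → Type _) p) ⟨q, Y⟩).2 := by
  rw [← Trivialization.continuousLinearMapAt_apply_of_mem (R := ℝ) _ hq]
  change _ = (e q).symm (Trivialization.symmL ℝ _ q (Trivialization.continuousLinearMapAt ℝ _ q Y))
  rw [Trivialization.symmL_continuousLinearMapAt _ hq]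

lemma frame_apply_triv {p q : M}
    (hq : q ∈ (trivializationAt E5 (TangentSpace (𝓡 5) : M → Type _) p).baseSet) (x : E5) :
    ((trivializationAt E5 (TangentSpace (𝓡 5) : M → Type _) p) ⟨q, e q x⟩).2
      = frameMat p e q x := by
  rw [← Trivialization.continuousLinearMapAt_apply_of_mem (R := ℝ) _ hq]
  rfl

lemma contMDiffAt_frame_symm (he : ∀ x, ContMDiffAt (𝓡 5) (𝓡 5).tangent ∞ (frameField e x) (b m))
    {Y : ∀ n, TangentSpace (𝓡 5) (b n)}
    (hY : ContMDiffAt J (𝓡 5).tangent ∞ (fun n => (⟨b n, Y n⟩ : TangentBundle (𝓡 5) M)) m) :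
    ContMDiffAt J 𝓘(ℝ, E5) ∞ (fun n => (e (b n)).symm (Y n)) m := by
  rw [contMDiffAt_totalSpace] at hY
  have h := ((contMDiffAt_frameMatInv he).comp m hY.1).clm_apply hY.2
  refine h.congr_of_eventuallyEq ?_
  filter_upwards [hY.1.continuousAt (baseSet_mem_nhds (b m))] with n hn
  exact frame_symm_eq hn _

lemma mdifferentiableAt_frame_symm
    (he : ∀ x, ContMDiffAt (𝓡 5) (𝓡 5).tangent ∞ (frameField e x) p)
    {Y : ∀ q : M, TangentSpace (𝓡 5) q} (hY : MDifferentiableAt (𝓡 5) (𝓡 5).tangent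
      (fun q => (⟨q, Y q⟩ : TangentBundle (𝓡 5) M)) p) :
    MDifferentiableAt (𝓡 5) 𝓘(ℝ, E5) (fun q => (e q).symm (Y q)) p := by
  rw [mdifferentiableAt_totalSpace] at hY
  have h := ((contMDiffAt_frameMatInv he).mdifferentiableAt (by simp)).clm_apply hY.2
  refine h.congr_of_eventuallyEq ?_
  filter_upwards [baseSet_mem_nhds p] with n hn
  exact frame_symm_eq hn _

lemma contMDiffAt_frame_apply (he : ∀ x, ContMDiffAt (𝓡 5) (𝓡 5).tangent ∞ (frameField e x) (b m))
    (hb : ContMDiffAt J (𝓡 5) ∞ b m) {f : N → E5} (hf : ContMDiffAt J 𝓘(ℝ, E5) ∞ f m) :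
    ContMDiffAt J (𝓡 5).tangent ∞ (fun n => (⟨b n, e (b n) (f n)⟩ : TangentBundle (𝓡 5) M)) m := by
  rw [contMDiffAt_totalSpace]
  refine ⟨hb, (((contMDiffAt_frameMat he).comp m hb).clm_apply hf).congr_of_eventuallyEq ?_⟩
  filter_upwards [hb.continuousAt (baseSet_mem_nhds (b m))] with n hn
  exact frame_apply_triv hn _

lemma mdifferentiableAt_frame_apply
    (he : ∀ x, ContMDiffAt (𝓡 5) (𝓡 5).tangent ∞ (frameField e x) p)
    {f : M → E5} (hf : MDifferentiableAt (𝓡 5) 𝓘(ℝ, E5) f p) :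
    MDifferentiableAt (𝓡 5) (𝓡 5).tangent
      (fun q => (⟨q, e q (f q)⟩ : TangentBundle (𝓡 5) M)) p := by
  rw [mdifferentiableAt_totalSpace]
  refine ⟨mdifferentiableAt_id,
    (((contMDiffAt_frameMat he).mdifferentiableAt (by simp)).clm_apply hf).congr_of_eventuallyEq ?_⟩
  filter_upwards [baseSet_mem_nhds p] with n hn
  exact frame_apply_triv hn _

lemma contMDiffAt_conjFrame (he : ∀ x, ContMDiffAt (𝓡 5) (𝓡 5).tangent ∞ (frameField e x) (b m))
    (hb : ContMDiffAt J (𝓡 5) ∞ b m) {F : N → E5 →L[ℝ] E5}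
    (hF : ContMDiffAt J 𝓘(ℝ, E5 →L[ℝ] E5) ∞ F m) :
    ContMDiffAt J endModel ∞ (fun n => (⟨b n, conjFrame (e (b n)) (F n)⟩ : EndBundle M)) m := by
  rw [contMDiffAt_hom_bundle]
  refine ⟨hb, ?_⟩
  have h := ((contMDiffAt_frameMat he).comp m hb).clm_comp
    (hF.clm_comp ((contMDiffAt_frameMatInv he).comp m hb))
  exact h

lemma contMDiffAt_exprIn {τ : EndBundle M}
    (he : ∀ x, ContMDiffAt (𝓡 5) (𝓡 5).tangent ∞ (frameField e x) τ.1) :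
    ContMDiffAt endModel 𝓘(ℝ, E5 →L[ℝ] E5) ∞ (fun τ : EndBundle M => exprIn (e τ.1) τ.2) τ := by
  refine contMDiffAt_clm fun x => ?_
  have hb : ContMDiffAt endModel (𝓡 5) ∞ (TotalSpace.proj : EndBundle M → M) τ :=
    contMDiffAt_proj (fun p : M => TangentSpace (𝓡 5) p →L[ℝ] TangentSpace (𝓡 5) p)
  refine contMDiffAt_frame_symm (b := TotalSpace.proj) he ?_
  refine ContMDiffAt.clm_bundle_apply (F₁ := E5) (F₂ := E5)
    (E₁ := (TangentSpace (𝓡 5) : M → Type _)) (E₂ := (TangentSpace (𝓡 5) : M → Type _))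
    (b := (TotalSpace.proj : EndBundle M → M))
    (ϕ := fun τ => τ.2) (v := fun τ => e τ.1 x) ?_ ?_
  · exact contMDiffAt_id
  · exact (he x).comp τ hb

/-! ### The connection form of a frame -/

/-- The connection form of `∇` with respect to the frame `e`. -/
def connForm (nabla : Connection M) (e : ∀ q : M, E5 ≃L[ℝ] TangentSpace (𝓡 5) q) (q : M)
    (X : TangentSpace (𝓡 5) q) : E5 →L[ℝ] E5 :=
  ∑ k, (EuclideanSpace.proj k : E5 →L[ℝ] ℝ).smulRight
    ((e q).symm (nabla (fun q => e q (stdVec k)) q X))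

lemma connForm_apply (nabla : Connection M) (q : M) (X : TangentSpace (𝓡 5) q) (x : E5) :
    connForm nabla e q X x = ∑ k, x k • (e q).symm (nabla (fun q => e q (stdVec k)) q X) := by
  simp [connForm]

lemma connForm_add (nabla : Connection M) (q : M) (X Y : TangentSpace (𝓡 5) q) :
    connForm nabla e q (X + Y) = connForm nabla e q X + connForm nabla e q Y := by
  ext1 x
  simp [connForm_apply, Finset.sum_add_distrib]

lemma connForm_smul (nabla : Connection M) (q : M) (c : ℝ) (X : TangentSpace (𝓡 5) q) :
    connForm nabla e q (c • X) = c • connForm nabla e q X := by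
  ext1 x
  simp [connForm_apply, Finset.smul_sum, smul_comm c]

/-- The Leibniz rule for finite sums. -/
lemma nabla_sum (nabla : Connection M) {ι : Type*} (t : Finset ι) (f : ι → M → ℝ)
    (s : ι → ∀ q : M, TangentSpace (𝓡 5) q)
    (hf : ∀ i ∈ t, MDifferentiableAt (𝓡 5) 𝓘(ℝ, ℝ) (f i) p)
    (hs : ∀ i ∈ t, MDifferentiableAt (𝓡 5) (𝓡 5).tangent
      (fun q => (⟨q, s i q⟩ : TangentBundle (𝓡 5) M)) p) (X : TangentSpace (𝓡 5) p) :
    nabla (fun q => ∑ i ∈ t, f i q • s i q) p X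
      = ∑ i ∈ t, (f i p • nabla (s i) p X + mvfderiv (𝓡 5) (f i) p X • s i p) := by
  classical
  induction t using Finset.induction_on with
  | empty =>
    have := congrFun nabla.zero p
    simp only [Finset.sum_empty]
    exact congrArg (fun A => A X) this
  | insert i t hi ih =>
    have h1 := fun j hj => hf j (Finset.mem_insert_of_mem hj)
    have h2 := fun j hj => hs j (Finset.mem_insert_of_mem hj)
    have hi1 := hf i (Finset.mem_insert_self i t)
    have hi2 := hs i (Finset.mem_insert_self i t)
    simp only [Finset.sum_insert hi]
    rw [← ih h1 h2]
    have hadd := nabla.isCovariantDerivativeOnUniv.add (x := p)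
      (σ := f i • s i) (σ' := fun q => ∑ i ∈ t, f i q • s i q)
      (MDifferentiableAt.smul_section hi1 hi2)
      (MDifferentiableAt.sum_section fun j hj => MDifferentiableAt.smul_section (h1 j hj) (h2 j hj))
    have hl := nabla.isCovariantDerivativeOnUniv.leibniz (x := p) hi2 hi1
    have := congrArg (fun A => A X) hadd
    rw [hl] at this
    exact this

/-- In a frame, `∇` is the derivative of the components plus the connection form. -/
lemma nabla_eq (nabla : Connection M)
    (he : ∀ x, ContMDiffAt (𝓡 5) (𝓡 5).tangent ∞ (frameField e x) p)
    {Y : ∀ q : M, TangentSpace (𝓡 5) q} (hY : MDifferentiableAt (𝓡 5) (𝓡 5).tangent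
      (fun q => (⟨q, Y q⟩ : TangentBundle (𝓡 5) M)) p) (X : TangentSpace (𝓡 5) p) :
    nabla Y p X = e p (mvfderiv (𝓡 5) (fun q => (e q).symm (Y q)) p X
      + connForm nabla e p X ((e p).symm (Y p))) := by
  have hf := mdifferentiableAt_frame_symm he hY
  have hYs : Y = fun q => ∑ k, ((e q).symm (Y q)) k • e q (stdVec k) := by
    ext1 q
    conv_lhs => rw [← (e q).apply_symm_apply (Y q), ← sum_smul_stdVec ((e q).symm (Y q)), map_sum]
    simp
  have hproj (k : Fin 5) : HasMFDerivAt (𝓡 5) 𝓘(ℝ, ℝ) (fun q => ((e q).symm (Y q)) k) p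
      ((EuclideanSpace.proj k : E5 →L[ℝ] ℝ) ∘L
        mfderiv (𝓡 5) 𝓘(ℝ, E5) (fun q => (e q).symm (Y q)) p) :=
    (EuclideanSpace.proj k : E5 →L[ℝ] ℝ).hasMFDerivAt.comp p hf.hasMFDerivAt
  have h := nabla_sum nabla Finset.univ (fun k q => ((e q).symm (Y q)) k)
    (fun k q => e q (stdVec k)) (fun k _ => (hproj k).mdifferentiableAt)
    (fun k _ => (he (stdVec k)).mdifferentiableAt (by simp)) X
  rw [← hYs] at h
  rw [h, Finset.sum_add_distrib, add_comm, map_add]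
  congr 1
  · conv_rhs => rw [← sum_smul_stdVec (mvfderiv (𝓡 5) (fun q => (e q).symm (Y q)) p X),
      map_sum]
    refine Finset.sum_congr rfl fun k _ => ?_
    rw [mvfderiv, (hproj k).mfderiv, map_smul]
    rfl
  · simp [connForm_apply]

end Manifold

section Manifold

variable {M : Type*} [TopologicalSpace M] [ChartedSpace E5 M] [IsManifold (𝓡 5) ∞ M]
  {p : M} {e : ∀ q : M, E5 ≃L[ℝ] TangentSpace (𝓡 5) q} {nabla : Connection M}

lemma nabla_frame (he : ∀ x, ContMDiffAt (𝓡 5) (𝓡 5).tangent ∞ (frameField e x) p)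
    (x : E5) (X : TangentSpace (𝓡 5) p) :
    nabla (fun q => e q x) p X = e p (connForm nabla e p X x) := by
  rw [nabla_eq nabla he ((he x).mdifferentiableAt (by simp))]
  simp [mvfderiv_const]

/-- The derivative of a curve of endomorphisms, expressed in the frame `e`: together with `dproj`
it determines a tangent vector of `End(TM)`. -/
def exprDeriv (e : ∀ q : M, E5 ≃L[ℝ] TangentSpace (𝓡 5) q) (τ : EndBundle M) :
    TangentSpace endModel τ →L[ℝ] (E5 →L[ℝ] E5) :=
  mvfderiv endModel (fun τ : EndBundle M => exprIn (e τ.1) τ.2) τ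

variable {τ : EndBundle M}

lemma mdifferentiableAt_proj_end : MDifferentiableAt endModel (𝓡 5)
    (TotalSpace.proj : EndBundle M → M) τ :=
  (contMDiffAt_proj (n := ∞)
    (fun p : M => TangentSpace (𝓡 5) p →L[ℝ] TangentSpace (𝓡 5) p)).mdifferentiableAt (by simp)

/-- A tangent vector of `End(TM)` vanishes if its projection to `M` and its derivative in a frame
do: a point of `End(TM)` is a smooth function of its base point and its expression. -/
lemma eq_zero_of_exprDeriv (he : ∀ x, ContMDiffAt (𝓡 5) (𝓡 5).tangent ∞ (frameField e x) τ.1)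
    {w : TangentSpace endModel τ} (h1 : dproj τ w = 0) (h2 : exprDeriv e τ w = 0) : w = 0 := by
  let G : M × (E5 →L[ℝ] E5) → EndBundle M := fun z => ⟨z.1, conjFrame (e z.1) z.2⟩
  let f : EndBundle M → M × (E5 →L[ℝ] E5) := fun τ => (τ.1, exprIn (e τ.1) τ.2)
  have hG : MDifferentiableAt ((𝓡 5).prod 𝓘(ℝ, E5 →L[ℝ] E5)) endModel G (f τ) :=
    (contMDiffAt_conjFrame (b := Prod.fst) (m := f τ) he contMDiffAt_fst
      contMDiffAt_snd).mdifferentiableAt (by simp)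
  have hE : MDifferentiableAt endModel 𝓘(ℝ, E5 →L[ℝ] E5)
      (fun τ : EndBundle M => exprIn (e τ.1) τ.2) τ :=
    (contMDiffAt_exprIn he).mdifferentiableAt (by simp)
  have hf : MDifferentiableAt endModel ((𝓡 5).prod 𝓘(ℝ, E5 →L[ℝ] E5)) f τ :=
    mdifferentiableAt_proj_end.prodMk hE
  have hid : G ∘ f = id := by
    ext1 τ
    simp only [Function.comp_apply, G, f, conjFrame_exprIn, id]
  have hw : mfderiv endModel ((𝓡 5).prod 𝓘(ℝ, E5 →L[ℝ] E5)) f τ w = 0 := by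
    have := mfderiv_prodMk mdifferentiableAt_proj_end hE
    rw [show f = fun τ => (TotalSpace.proj τ, exprIn (e τ.1) τ.2) from rfl, this]
    exact Prod.ext h1 h2
  have hc := mfderiv_comp τ hG hf
  rw [hid, mfderiv_id] at hc
  have := congrArg (fun A => A w) hc
  refine this.trans ?_
  change mfderiv _ _ G (f τ) (mfderiv endModel ((𝓡 5).prod 𝓘(ℝ, E5 →L[ℝ] E5)) f τ w) = 0
  rw [hw, ContinuousLinearMap.map_zero]

lemma ext_tangent (he : ∀ x, ContMDiffAt (𝓡 5) (𝓡 5).tangent ∞ (frameField e x) τ.1)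
    {w w' : TangentSpace endModel τ} (h1 : dproj τ w = dproj τ w')
    (h2 : exprDeriv e τ w = exprDeriv e τ w') : w = w' := by
  rw [← sub_eq_zero]
  exact eq_zero_of_exprDeriv he (by rw [ContinuousLinearMap.map_sub, h1, sub_self])
    (by rw [ContinuousLinearMap.map_sub, h2, sub_self])

/-! ### Vertical and horizontal lifts -/

section VertLift

variable (v : TangentSpace (𝓡 5) τ.1 →L[ℝ] TangentSpace (𝓡 5) τ.1)

lemma mdifferentiableAt_line (he : ∀ x, ContMDiffAt (𝓡 5) (𝓡 5).tangent ∞ (frameField e x) τ.1) :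
    MDifferentiableAt 𝓘(ℝ, ℝ) endModel (fun t : ℝ => (⟨τ.1, τ.2 + t • v⟩ : EndBundle M)) 0 := by
  have h := contMDiffAt_conjFrame (J := 𝓘(ℝ, ℝ)) (m := (0 : ℝ)) (b := fun _ : ℝ => τ.1)
    (F := fun t : ℝ => exprIn (e τ.1) τ.2 + t • exprIn (e τ.1) v) he contMDiffAt_const
    (by
      have : ContDiff ℝ ∞ (fun t : ℝ => exprIn (e τ.1) τ.2 + t • exprIn (e τ.1) v) := by fun_prop
      exact this.contMDiff.contMDiffAt)
  simp only [← exprIn_smul, ← exprIn_add, conjFrame_exprIn] at h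
  exact h.mdifferentiableAt (by simp)

/-- The chain rule for a composition at a point which is given by an equation. -/
lemma mfderiv_comp_apply_of_eq {EA EB EC HA HB HC A B C : Type*}
    [NormedAddCommGroup EA] [NormedSpace ℝ EA] [NormedAddCommGroup EB] [NormedSpace ℝ EB]
    [NormedAddCommGroup EC] [NormedSpace ℝ EC] [TopologicalSpace HA] [TopologicalSpace HB]
    [TopologicalSpace HC] {IA : ModelWithCorners ℝ EA HA} {IB : ModelWithCorners ℝ EB HB}
    {IC : ModelWithCorners ℝ EC HC} [TopologicalSpace A] [ChartedSpace HA A]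
    [TopologicalSpace B] [ChartedSpace HB B] [TopologicalSpace C] [ChartedSpace HC C]
    {g : B → C} {f : A → B} {x : A} {y : B} (hy : f x = y)
    (hg : MDifferentiableAt IB IC g y) (hf : MDifferentiableAt IA IB f x) (v : EA) :
    (mfderiv IA IC (g ∘ f) x v : EC) = (mfderiv IB IC g y (mfderiv IA IB f x v : EB) : EC) := by
  subst hy
  rw [mfderiv_comp x hg hf]
  rfl

lemma dproj_vertLift (he : ∀ x, ContMDiffAt (𝓡 5) (𝓡 5).tangent ∞ (frameField e x) τ.1) :
    dproj τ (vertLift τ v) = 0 := by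
  have h0 : (⟨τ.1, τ.2 + (0 : ℝ) • v⟩ : EndBundle M) = τ := by simp
  have hc := mfderiv_comp_apply_of_eq (x := (0 : ℝ))
    (f := fun t : ℝ => (⟨τ.1, τ.2 + t • v⟩ : EndBundle M)) h0 mdifferentiableAt_proj_end
    (mdifferentiableAt_line v he) (1 : ℝ)
  have hconst : (TotalSpace.proj : EndBundle M → M) ∘
      (fun t : ℝ => (⟨τ.1, τ.2 + t • v⟩ : EndBundle M)) = fun _ => τ.1 := rfl
  rw [hconst, mfderiv_const] at hc
  exact hc.symm

lemma exprDeriv_vertLift (he : ∀ x, ContMDiffAt (𝓡 5) (𝓡 5).tangent ∞ (frameField e x) τ.1) :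
    exprDeriv e τ (vertLift τ v) = exprIn (e τ.1) v := by
  have h0 : (⟨τ.1, τ.2 + (0 : ℝ) • v⟩ : EndBundle M) = τ := by simp
  have hc := mfderiv_comp_apply_of_eq (x := (0 : ℝ))
    (f := fun t : ℝ => (⟨τ.1, τ.2 + t • v⟩ : EndBundle M)) h0
    ((contMDiffAt_exprIn he).mdifferentiableAt (by simp)) (mdifferentiableAt_line v he) (1 : ℝ)
  have hline : (fun τ : EndBundle M => exprIn (e τ.1) τ.2) ∘
      (fun t : ℝ => (⟨τ.1, τ.2 + t • v⟩ : EndBundle M))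
      = fun t : ℝ => exprIn (e τ.1) τ.2 + t • exprIn (e τ.1) v := by
    ext1 t
    simp only [Function.comp_apply, exprIn_add, exprIn_smul]
  have hd : HasDerivAt (fun t : ℝ => exprIn (e τ.1) τ.2 + t • exprIn (e τ.1) v)
      (exprIn (e τ.1) v) 0 := by
    simpa using ((hasDerivAt_id' (0 : ℝ)).smul_const (exprIn (e τ.1) v)).const_add
      (exprIn (e τ.1) τ.2)
  refine hc.symm.trans ?_
  rw [hline, mfderiv_eq_fderiv, hd.hasFDerivAt.fderiv]
  exact one_smul ℝ _

end VertLift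

/-- The derivative along `X` of the expression in the frame `e` of a parallel endomorphism whose
expression at `q` is `F`. -/
def parallelDeriv (nabla : Connection M) (e : ∀ q : M, E5 ≃L[ℝ] TangentSpace (𝓡 5) q) (q : M)
    (X : TangentSpace (𝓡 5) q) (F : E5 →L[ℝ] E5) : E5 →L[ℝ] E5 :=
  F ∘L connForm nabla e q X - connForm nabla e q X ∘L F

/-- A horizontal lift is unique: its projection and its derivative in a frame are determined. -/
lemma IsHorizontalLift.derivs
    (he : ∀ x, ContMDiffAt (𝓡 5) (𝓡 5).tangent ∞ (frameField e x) τ.1)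
    {X : TangentSpace (𝓡 5) τ.1} {w : TangentSpace endModel τ}
    (h : IsHorizontalLift nabla τ X w) :
    dproj τ w = X ∧ exprDeriv e τ w = parallelDeriv nabla e τ.1 X (exprIn (e τ.1) τ.2) := by
  obtain ⟨p, F⟩ := τ
  obtain ⟨s, hs, hsm, hpar, rfl⟩ := h
  dsimp only at hs hsm hpar he X ⊢
  subst hs
  have hsd := hsm.mdifferentiableAt (by simp)
  have hE := (contMDiffAt_exprIn (τ := (⟨p, s p⟩ : EndBundle M)) he).mdifferentiableAt (by simp)
  constructor
  · have hc := mfderiv_comp p (mdifferentiableAt_proj_end (τ := (⟨p, s p⟩ : EndBundle M))) hsd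
    have hid : (TotalSpace.proj : EndBundle M → M) ∘ (fun q => (⟨q, s q⟩ : EndBundle M)) = id := rfl
    rw [hid, mfderiv_id] at hc
    exact (congrArg (fun A => A X) hc).symm
  · have hc := mfderiv_comp p hE hsd
    have hŝ : MDifferentiableAt (𝓡 5) 𝓘(ℝ, E5 →L[ℝ] E5) (fun q => exprIn (e q) (s q)) p :=
      MDifferentiableAt.comp p hE hsd
    have hexpr : exprDeriv e (⟨p, s p⟩ : EndBundle M)
        (mfderiv (𝓡 5) endModel (fun q => (⟨q, s q⟩ : EndBundle M)) p X)
        = mvfderiv (𝓡 5) (fun q => exprIn (e q) (s q)) p X :=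
      (congrArg (fun A => A X) hc).symm
    rw [hexpr]
    ext1 x
    have hY := (he x).mdifferentiableAt (by simp)
    have h1 := hpar (fun q => e q x) hY
    have hsY : MDifferentiableAt (𝓡 5) (𝓡 5).tangent
        (fun q => (⟨q, s q (e q x)⟩ : TangentBundle (𝓡 5) M)) p :=
      MDifferentiableAt.clm_bundle_apply (b := id) (ϕ := s) (v := fun q => e q x) hsd hY
    rw [nabla_frame he, nabla_eq nabla he hsY] at h1
    have h2 : mvfderiv (𝓡 5) (fun q => (e q).symm (s q (e q x))) p X
        = mvfderiv (𝓡 5) (fun q => exprIn (e q) (s q)) p X x := by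
      have := ((ContinuousLinearMap.apply ℝ E5 x).hasMFDerivAt
        (x := exprIn (e p) (s p))).comp p hŝ.hasMFDerivAt
      exact congrArg (fun A => A X) this.mfderiv
    rw [h2] at h1
    have h3 := congrArg (e p).symm h1
    rw [ContinuousLinearEquiv.symm_apply_apply] at h3
    rw [eq_sub_of_add_eq h3]
    rfl

end Manifold

section Manifold

variable {M : Type*} [TopologicalSpace M] [ChartedSpace E5 M] [IsManifold (𝓡 5) ∞ M]
  {p : M} {e : ∀ q : M, E5 ≃L[ℝ] TangentSpace (𝓡 5) q} {nabla : Connection M}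
  {τ : EndBundle M}

/-- There are smooth maps into a vector space with prescribed value and derivative at `p`: affine
maps in the chart. -/
lemma exists_smooth_with_deriv {F : Type*} [NormedAddCommGroup F] [NormedSpace ℝ F] (p : M) (c : F)
    (L : TangentSpace (𝓡 5) p →ₗ[ℝ] F) : ∃ f : M → F, f p = c ∧
      ContMDiffOn (𝓡 5) 𝓘(ℝ, F) ∞ f (chartAt E5 p).source ∧ ∀ X, mvfderiv (𝓡 5) f p X = L X := by
  let L' : E5 →L[ℝ] F := LinearMap.toContinuousLinearMap (E := E5) L
  let φ : M → E5 := fun q => extChartAt (𝓡 5) p q - extChartAt (𝓡 5) p p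
  have hφ : ContMDiffOn (𝓡 5) 𝓘(ℝ, E5) ∞ φ (chartAt E5 p).source :=
    (contMDiffOn_extChartAt (I := 𝓡 5) (n := ∞) (x := p)).sub contMDiffOn_const
  have hφd : HasMFDerivAt (𝓡 5) 𝓘(ℝ, E5) φ p (ContinuousLinearMap.id ℝ E5) := by
    have h1 := (mdifferentiableAt_extChartAt (I := 𝓡 5) (mem_chart_source E5 p)).hasMFDerivAt
    rw [mfderiv_extChartAt_self] at h1
    have := h1.sub (hasMFDerivAt_const (extChartAt (𝓡 5) p p) p)
    exact this.congr_mfderiv (sub_zero (ContinuousLinearMap.id ℝ E5))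
  refine ⟨fun q => c + L' (φ q), by simp [φ], ?_, fun X => ?_⟩
  · exact contMDiffOn_const.add (L'.contMDiff.comp_contMDiffOn hφ)
  · have h2 := (L'.hasMFDerivAt (x := φ p)).comp p hφd
    have h3 := (hasMFDerivAt_const c p).add h2
    exact congrArg (fun A => A X) h3.mfderiv |>.trans (zero_add _)

lemma mvfderiv_clm_apply {F : M → E5 →L[ℝ] E5} {y : M → E5}
    (hF : MDifferentiableAt (𝓡 5) 𝓘(ℝ, E5 →L[ℝ] E5) F p)
    (hy : MDifferentiableAt (𝓡 5) 𝓘(ℝ, E5) y p) (X : TangentSpace (𝓡 5) p) :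
    mvfderiv (𝓡 5) (fun q => F q (y q)) p X
      = mvfderiv (𝓡 5) F p X (y p) + F p (mvfderiv (𝓡 5) y p X) := by
  have hF' := hF.hasMFDerivAt
  have hy' := hy.hasMFDerivAt
  have h : HasMFDerivAt (𝓡 5) 𝓘(ℝ, E5) (fun q => F q (y q)) p _ :=
    ⟨hF'.1.clm_apply hy'.1, hF'.2.clm_apply hy'.2⟩
  refine (congrArg (fun A => A X) h.mfderiv).trans ?_
  refine (add_comm _ _).trans ?_
  congr 1
  · exact congrArg _ (congrArg y (extChartAt_to_inv (I := 𝓡 5) p))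
  · exact congrArg (fun q => F q _) (extChartAt_to_inv (I := 𝓡 5) p)

/-- Horizontal lifts exist: a section is parallel in the direction of `X` at `p` if its expression
in a frame has the derivative prescribed by the connection form. -/
lemma exists_isHorizontalLift (nabla : Connection M)
    (he : ∀ x, ContMDiffAt (𝓡 5) (𝓡 5).tangent ∞ (frameField e x) τ.1)
    (X : TangentSpace (𝓡 5) τ.1) : ∃ w, IsHorizontalLift nabla τ X w := by
  obtain ⟨p, F⟩ := τ
  dsimp only at he X
  obtain ⟨f, hfp, hfs, hfd⟩ := exists_smooth_with_deriv p (exprIn (e p) F)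
    { toFun := fun X => parallelDeriv nabla e p X (exprIn (e p) F)
      map_add' := fun X Y => by
        simp only [parallelDeriv, connForm_add, ContinuousLinearMap.comp_add,
          ContinuousLinearMap.add_comp]
        abel
      map_smul' := fun c X => by
        simp only [parallelDeriv, connForm_smul, ContinuousLinearMap.comp_smul,
          ContinuousLinearMap.smul_comp, smul_sub, RingHom.id_apply] }
  replace hfs := hfs.contMDiffAt (chart_source_mem_nhds E5 p)
  refine ⟨_, fun q => conjFrame (e q) (f q), ?_, ?_, fun Y hY => ?_, rfl⟩
  · change conjFrame (e p) (f p) = F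
    rw [hfp, conjFrame_exprIn]
  · exact contMDiffAt_conjFrame (b := id) he contMDiffAt_id hfs
  · have hy := mdifferentiableAt_frame_symm he hY
    have hf := hfs.mdifferentiableAt (by simp)
    have hsY := mdifferentiableAt_frame_apply he (hf.clm_apply hy)
    have h1 := nabla_eq nabla he hsY X
    simp only [ContinuousLinearEquiv.symm_apply_apply] at h1
    refine h1.trans ?_
    rw [mvfderiv_clm_apply hf hy, hfd, nabla_eq nabla he hY, conjFrame_apply, hfp,
      ContinuousLinearEquiv.symm_apply_apply]
    congr 1
    simp only [LinearMap.coe_mk, AddHom.coe_mk, parallelDeriv, map_add,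
      sub_apply, ContinuousLinearMap.comp_apply]
    abel

lemma isHorizontalLift_horLift
    (he : ∀ x, ContMDiffAt (𝓡 5) (𝓡 5).tangent ∞ (frameField e x) τ.1)
    (X : TangentSpace (𝓡 5) τ.1) : IsHorizontalLift nabla τ X (horLift nabla τ X) :=
  Classical.epsilon_spec (exists_isHorizontalLift nabla he X)

lemma dproj_horLift (he : ∀ x, ContMDiffAt (𝓡 5) (𝓡 5).tangent ∞ (frameField e x) τ.1)
    (X : TangentSpace (𝓡 5) τ.1) : dproj τ (horLift nabla τ X) = X :=
  ((isHorizontalLift_horLift he X).derivs he).1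

lemma exprDeriv_horLift (he : ∀ x, ContMDiffAt (𝓡 5) (𝓡 5).tangent ∞ (frameField e x) τ.1)
    (X : TangentSpace (𝓡 5) τ.1) : exprDeriv e τ (horLift nabla τ X)
      = parallelDeriv nabla e τ.1 X (exprIn (e τ.1) τ.2) :=
  ((isHorizontalLift_horLift he X).derivs he).2

lemma horLift_add (he : ∀ x, ContMDiffAt (𝓡 5) (𝓡 5).tangent ∞ (frameField e x) τ.1)
    (X Y : TangentSpace (𝓡 5) τ.1) :
    horLift nabla τ (X + Y) = horLift nabla τ X + horLift nabla τ Y := by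
  apply ext_tangent he
  · rw [ContinuousLinearMap.map_add, dproj_horLift he, dproj_horLift he, dproj_horLift he]
  · rw [ContinuousLinearMap.map_add, exprDeriv_horLift he, exprDeriv_horLift he,
      exprDeriv_horLift he]
    simp only [parallelDeriv, connForm_add, ContinuousLinearMap.comp_add,
      ContinuousLinearMap.add_comp]
    abel

lemma horLift_smul (he : ∀ x, ContMDiffAt (𝓡 5) (𝓡 5).tangent ∞ (frameField e x) τ.1)
    (c : ℝ) (X : TangentSpace (𝓡 5) τ.1) : horLift nabla τ (c • X) = c • horLift nabla τ X := by
  apply ext_tangent he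
  · rw [ContinuousLinearMap.map_smul, dproj_horLift he, dproj_horLift he]
  · rw [ContinuousLinearMap.map_smul, exprDeriv_horLift he, exprDeriv_horLift he]
    simp only [parallelDeriv, connForm_smul, ContinuousLinearMap.comp_smul,
      ContinuousLinearMap.smul_comp, smul_sub]

lemma vertLift_zero (he : ∀ x, ContMDiffAt (𝓡 5) (𝓡 5).tangent ∞ (frameField e x) τ.1) :
    vertLift τ 0 = 0 := by
  apply eq_zero_of_exprDeriv he (dproj_vertLift 0 he)
  rw [exprDeriv_vertLift 0 he]
  ext1 x
  simp [exprIn_apply]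

/-- `vertPart` chooses some vertical component; it is unique since `vertLift` is injective. -/
lemma vertPart_horLift (he : ∀ x, ContMDiffAt (𝓡 5) (𝓡 5).tangent ∞ (frameField e x) τ.1)
    (X : TangentSpace (𝓡 5) τ.1) : vertPart nabla τ (horLift nabla τ X) = 0 := by
  have hex : ∃ v, horLift nabla τ X
      = horLift nabla τ (dproj τ (horLift nabla τ X)) + vertLift τ v :=
    ⟨0, by rw [dproj_horLift he, vertLift_zero he, add_zero]⟩
  have h : horLift nabla τ X = horLift nabla τ (dproj τ (horLift nabla τ X))
    + vertLift τ (vertPart nabla τ (horLift nabla τ X)) := Classical.epsilon_spec hex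
  rw [dproj_horLift he, left_eq_add] at h
  have h2 := exprDeriv_vertLift (vertPart nabla τ (horLift nabla τ X)) he
  rw [h, ContinuousLinearMap.map_zero] at h2
  rw [← conjFrame_exprIn (e τ.1) (vertPart nabla τ (horLift nabla τ X)), ← h2]
  ext1 x
  simp [conjFrame_apply]

/-! ### The contact distribution in a frame -/

variable {S : IrreducibleSO3Structure M} {U : Set M}

lemma IsAdaptedFrame.contMDiffAt (hf : IsAdaptedFrame S U e) {q : M} (hq : q ∈ U) (x : E5) :
    ContMDiffAt (𝓡 5) (𝓡 5).tangent ∞ (frameField e x) q :=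
  (hf.smooth x).contMDiffAt (hf.isOpen.mem_nhds hq)

lemma innerAt_zero_right (p : M) (F : TangentSpace (𝓡 5) p →L[ℝ] TangentSpace (𝓡 5) p) :
    innerAt S p F 0 = 0 := by
  have : toModel S p 0 = 0 := by ext1 x; simp [toModel]
  rw [innerAt, this]
  simp [innerEnd]

lemma twistorStructure_chi (t : ℝ) (ε : ℤˣ) (n : ℕ) (hf : IsAdaptedFrame S U e) (hq : τ.1 ∈ U)
    (hτ : τ ∈ twistorSpace S) : (twistorStructure S nabla t ε n).chi τ
      = horLift nabla τ (e τ.1 (xiVec (coordY (exprIn (e τ.1) τ.2)))) := by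
  rw [← xiAt_eq (hf.mem _ hq) hτ.1]
  rfl

/-- The contact form `h(·, χ)` in terms of an adapted frame. -/
lemma twistorStructure_h_chi (t : ℝ) (ε : ℤˣ) (n : ℕ) (hf : IsAdaptedFrame S U e) (hq : τ.1 ∈ U)
    (hτ : τ ∈ twistorSpace S) (w : TangentSpace endModel τ) :
    (twistorStructure S nabla t ε n).h τ w ((twistorStructure S nabla t ε n).chi τ)
      = inner ℝ ((e τ.1).symm (dproj τ w)) (xiVec (coordY (exprIn (e τ.1) τ.2))) := by
  have he := hf.contMDiffAt hq
  rw [twistorStructure_chi t ε n hf hq hτ]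
  change metric S τ.1 (dproj τ w) (dproj τ (horLift nabla τ _))
    + t * innerAt S τ.1 (vertPart nabla τ w) (vertPart nabla τ (horLift nabla τ _)) = _
  rw [dproj_horLift he, vertPart_horLift he, innerAt_zero_right, mul_zero, add_zero,
    metric_eq (hf.mem _ hq), ContinuousLinearEquiv.symm_apply_apply]

lemma mem_twistorSpace_iff (hf : IsAdaptedFrame S U e) (hq : τ.1 ∈ U) :
    τ ∈ twistorSpace S ↔ exprIn (e τ.1) τ.2 = kap (coordY (exprIn (e τ.1) τ.2)) ∧
      coordY (exprIn (e τ.1) τ.2) 0 ^ 2 + coordY (exprIn (e τ.1) τ.2) 1 ^ 2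
        + coordY (exprIn (e τ.1) τ.2) 2 ^ 2 = 1 := by
  change τ.2 ∈ Lambda23At S τ.1 ∧ innerAt S τ.1 τ.2 τ.2 = 5 ↔ _
  rw [mem_Lambda23At_iff (hf.mem _ hq), innerAt_eq (hf.mem _ hq), mem_Lambda23_iff]
  refine and_congr_right fun h => ?_
  have := innerEnd_kap (coordY (exprIn (e τ.1) τ.2)) (coordY (exprIn (e τ.1) τ.2))
  rw [← h] at this
  rw [this]
  constructor <;> intro h <;> linarith

end Manifold

section Manifold

variable {M : Type*} [TopologicalSpace M] [ChartedSpace E5 M] [IsManifold (𝓡 5) ∞ M]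
  {p : M} {e : ∀ q : M, E5 ≃L[ℝ] TangentSpace (𝓡 5) q} {nabla : Connection M}
  {τ : EndBundle M}

/-! ### Coordinates on `End(TM)` defined by a frame -/

/-- Coordinates on `End(TM)` over a chart domain, in which the endomorphisms are expressed in the
frame `e`. -/
def endCoord (p : M) (e : ∀ q : M, E5 ≃L[ℝ] TangentSpace (𝓡 5) q) (τ : EndBundle M) :
    E5 × (E5 →L[ℝ] E5) :=
  (extChartAt (𝓡 5) p τ.1, exprIn (e τ.1) τ.2)

lemma contMDiffAt_endCoord (hp : τ.1 ∈ (chartAt E5 p).source)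
    (he : ∀ x, ContMDiffAt (𝓡 5) (𝓡 5).tangent ∞ (frameField e x) τ.1) :
    ContMDiffAt endModel 𝓘(ℝ, E5 × (E5 →L[ℝ] E5)) ∞ (endCoord p e) τ := by
  have hb : ContMDiffAt endModel (𝓡 5) ∞ (TotalSpace.proj : EndBundle M → M) τ :=
    contMDiffAt_proj (fun p : M => TangentSpace (𝓡 5) p →L[ℝ] TangentSpace (𝓡 5) p)
  exact ((contMDiffAt_extChartAt' hp).comp τ hb).prodMk_space (contMDiffAt_exprIn he)

lemma mfderiv_endCoord (hp : τ.1 ∈ (chartAt E5 p).source)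
    (he : ∀ x, ContMDiffAt (𝓡 5) (𝓡 5).tangent ∞ (frameField e x) τ.1)
    (w : TangentSpace endModel τ) :
    (mfderiv endModel 𝓘(ℝ, E5 × (E5 →L[ℝ] E5)) (endCoord p e) τ w : E5 × (E5 →L[ℝ] E5))
      = (frameMat p e τ.1 ((e τ.1).symm (dproj τ w)), exprDeriv e τ w) := by
  have h := (contMDiffAt_endCoord hp he).mdifferentiableAt (by simp)
  have h1 := (ContinuousLinearMap.fst ℝ E5 (E5 →L[ℝ] E5)).hasMFDerivAt.comp τ h.hasMFDerivAt
  have h2 := (ContinuousLinearMap.snd ℝ E5 (E5 →L[ℝ] E5)).hasMFDerivAt.comp τ h.hasMFDerivAt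
  have h3 := ((contMDiffAt_extChartAt' (I := 𝓡 5) (n := ∞) hp).mdifferentiableAt
    (by simp)).hasMFDerivAt.comp τ mdifferentiableAt_proj_end.hasMFDerivAt
  have h13 := hasMFDerivAt_unique h1 h3
  rw [← TangentBundle.continuousLinearMapAt_trivializationAt hp] at h13
  have hfm : frameMat p e τ.1 ((e τ.1).symm (dproj τ w))
      = (trivializationAt E5 (TangentSpace (𝓡 5) : M → Type _) p).continuousLinearMapAt ℝ τ.1
        (dproj τ w) :=
    congrArg _ ((e τ.1).apply_symm_apply (dproj τ w))
  refine Prod.ext ?_ ?_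
  · exact (congrArg (fun A => A w) h13).trans hfm.symm
  · exact (congrArg (fun A => A w) h2.mfderiv).symm

lemma isInvertible_of_injective {V : Type*} [NormedAddCommGroup V] [NormedSpace ℝ V]
    [FiniteDimensional ℝ V] (A : V →L[ℝ] V) (h : Function.Injective A) : A.IsInvertible :=
  ⟨(LinearEquiv.ofInjectiveEndo A.toLinearMap h).toContinuousLinearEquiv, rfl⟩

lemma isInvertible_mfderiv_endCoord (hp : τ.1 ∈ (chartAt E5 p).source)
    (he : ∀ x, ContMDiffAt (𝓡 5) (𝓡 5).tangent ∞ (frameField e x) τ.1) :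
    (mfderiv endModel 𝓘(ℝ, E5 × (E5 →L[ℝ] E5)) (endCoord p e) τ).IsInvertible := by
  refine isInvertible_of_injective (V := E5 × (E5 →L[ℝ] E5)) _ fun w w' h => ?_
  have h1 := (mfderiv_endCoord hp he w).symm.trans (h.trans (mfderiv_endCoord hp he w'))
  obtain ⟨h1, h2⟩ := Prod.mk.inj h1
  refine ext_tangent he ?_ h2
  have hb : τ.1 ∈ (trivializationAt E5 (TangentSpace (𝓡 5) : M → Type _) p).baseSet := by
    rwa [TangentBundle.trivializationAt_baseSet]
  have := congrArg (frameMatInv p e τ.1) h1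
  rw [frameMatInv_frameMat hb, frameMatInv_frameMat hb] at this
  exact (e τ.1).symm.injective this

/-- A vector field on `End(TM)` is the pullback of its expression in the coordinates. -/
lemma eventuallyEq_mpullback_endCoord {V : ∀ τ : EndBundle M, TangentSpace endModel τ}
    {V' : E5 × (E5 →L[ℝ] E5) → E5 × (E5 →L[ℝ] E5)} {U : Set M} (hU : U ∈ 𝓝 τ.1)
    (he : ∀ q ∈ U, ∀ x, ContMDiffAt (𝓡 5) (𝓡 5).tangent ∞ (frameField e x) q)
    (hV : ∀ ρ : EndBundle M, ρ.1 ∈ U → ρ.1 ∈ (chartAt E5 τ.1).source →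
      (frameMat τ.1 e ρ.1 ((e ρ.1).symm (dproj ρ (V ρ))), exprDeriv e ρ (V ρ))
        = V' (endCoord τ.1 e ρ)) :
    V =ᶠ[𝓝 τ] VectorField.mpullback endModel 𝓘(ℝ, E5 × (E5 →L[ℝ] E5)) (endCoord τ.1 e) V' := by
  have hc : ContinuousAt (TotalSpace.proj : EndBundle M → M) τ :=
    mdifferentiableAt_proj_end.continuousAt
  filter_upwards [hc hU, hc (chart_source_mem_nhds E5 τ.1)] with ρ h1 h2
  refine Eq.symm ((isInvertible_mfderiv_endCoord h2 (he _ h1)).inverse_apply_eq.mpr ?_)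
  exact ((mfderiv_endCoord h2 (he _ h1) (V ρ)).trans (hV ρ h1 h2)).symm

/-! ### Smoothness of the connection form -/

variable {S : IrreducibleSO3Structure M} {U : Set M}

/-- The smoothness of `∇` concerns global sections; a local frame field is cut off by a bump
function. -/
lemma contMDiffAt_nabla_frame [T2Space M]
    (hsmooth : CovariantDerivative.ContMDiffCovariantDerivative nabla ∞)
    (hf : IsAdaptedFrame S U e) (hp : p ∈ U) (y : E5) :
    ContMDiffAt (𝓡 5) endModel ∞
      (fun q => (⟨q, nabla (fun q => e q y) q⟩ : EndBundle M)) p := by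
  obtain ⟨ψ, -, hψ⟩ := (SmoothBumpFunction.nhds_basis_tsupport (I := 𝓡 5) p).mem_iff.mp
    (hf.isOpen.mem_nhds hp)
  have hs := ContMDiffOn.smul_section_of_tsupport (V := (TangentSpace (𝓡 5) : M → Type _))
    (s := fun q => e q y) (ψ := ψ) (ψ.contMDiff).contMDiffOn hf.isOpen hψ (hf.smooth y)
  have h := (hsmooth.contMDiff.contMDiff (σ := ⇑ψ • fun q => e q y) hs.contMDiffOn).contMDiffAt
    (x := p) univ_mem
  refine h.congr_of_eventuallyEq ?_
  filter_upwards [ψ.eventuallyEq_one.eventuallyEq_nhds, hf.isOpen.mem_nhds hp] with q hq hqU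
  congr 1
  refine nabla.isCovariantDerivativeOnUniv.congr_of_eventuallyEq
    ((hf.contMDiffAt hqU y).mdifferentiableAt (by simp)) ((hs q).mdifferentiableAt (by simp))
    univ_mem ?_
  filter_upwards [hq] with r hr
  simp [hr]

lemma contMDiffAt_connForm [T2Space M]
    (hsmooth : CovariantDerivative.ContMDiffCovariantDerivative nabla ∞)
    (hf : IsAdaptedFrame S U e) (hp : p ∈ U) (x : E5) :
    ContMDiffAt (𝓡 5) 𝓘(ℝ, E5 →L[ℝ] E5) ∞ (fun q => connForm nabla e q (e q x)) p := by
  refine contMDiffAt_clm fun y => ?_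
  simp only [connForm_apply]
  refine ContMDiffAt.sum fun k _ => ?_
  have h : ContMDiffAt (𝓡 5) 𝓘(ℝ, E5) ∞
      (fun q => (e q).symm (nabla (fun q => e q (stdVec k)) q (e q x))) p := by
    refine contMDiffAt_frame_symm (b := id) (hf.contMDiffAt hp) ?_
    exact ContMDiffAt.clm_bundle_apply (F₁ := E5) (F₂ := E5)
      (E₁ := (TangentSpace (𝓡 5) : M → Type _)) (E₂ := (TangentSpace (𝓡 5) : M → Type _))
      (b := id) (ϕ := fun q => nabla (fun q => e q (stdVec k)) q) (v := fun q => e q x)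
      (contMDiffAt_nabla_frame hsmooth hf hp (stdVec k)) (hf.contMDiffAt hp x)
  have hk : ContMDiffAt (𝓡 5) 𝓘(ℝ, ℝ) ∞ (fun _ : M => y k) p := contMDiffAt_const
  exact hk.smul h

end Manifold

/-! ### The two vector fields in coordinates -/

lemma innerEnd_comm (F G : E5 →L[ℝ] E5) : innerEnd F G = innerEnd G F := by
  simp only [innerEnd, real_inner_comm]

lemma clm_smul_zero (s : ℝ) : s • (0 : E5 →L[ℝ] E5) = 0 := by
  ext1 x
  simp

lemma two_le_infty : (2 : WithTop ℕ∞) ≤ ∞ :=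
  WithTop.coe_le_coe.2 (le_top : (2 : ℕ∞) ≤ ⊤)

lemma contDiff_coordY (i : Fin 3) : ContDiff ℝ ∞ (fun F => coordY F i) := by
  unfold coordY innerEnd
  refine ContDiff.div_const (contDiff_const.mul (ContDiff.sum fun j _ => ?_)) _
  exact ContDiff.inner ℝ (contDiff_id.clm_apply contDiff_const) contDiff_const

section Manifold

variable {M : Type*} [TopologicalSpace M] [ChartedSpace E5 M] [IsManifold (𝓡 5) ∞ M]
  {p : M} {e : ∀ q : M, E5 ≃L[ℝ] TangentSpace (𝓡 5) q} {nabla : Connection M}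
  {τ : EndBundle M} {S : IrreducibleSO3Structure M} {U : Set M}

/-- The horizontal lift of the vector field with constant components `x` in the frame, in the
coordinates `endCoord p e`. -/
def horModel (nabla : Connection M) (p : M) (e : ∀ q : M, E5 ≃L[ℝ] TangentSpace (𝓡 5) q) (x : E5)
    (z : E5 × (E5 →L[ℝ] E5)) : E5 × (E5 →L[ℝ] E5) :=
  (frameMat p e ((extChartAt (𝓡 5) p).symm z.1) x,
    parallelDeriv nabla e ((extChartAt (𝓡 5) p).symm z.1) (e ((extChartAt (𝓡 5) p).symm z.1) x) z.2)

/-- The vector field `κ̃₁` in the coordinates `endCoord p e`. -/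
def kappaModel (z : E5 × (E5 →L[ℝ] E5)) : E5 × (E5 →L[ℝ] E5) :=
  (0, kappa 0 - coordY z.2 0 • z.2)

/-- The vector field `A` in the coordinates `endCoord p e`. -/
def fieldAModel (nabla : Connection M) (p : M) (e : ∀ q : M, E5 ≃L[ℝ] TangentSpace (𝓡 5) q)
    (z : E5 × (E5 →L[ℝ] E5)) : E5 × (E5 →L[ℝ] E5) :=
  (√3 * coordY z.2 0 * coordY z.2 2) • horModel nabla p e (stdVec 0) z
    - (coordY z.2 0 ^ 2 / 2 + coordY z.2 1 ^ 2 / 2 - coordY z.2 2 ^ 2)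
      • horModel nabla p e (stdVec 2) z

lemma yCoord_eq (hf : IsAdaptedFrame S U e) (hq : τ.1 ∈ U) (i : Fin 3) :
    yCoord S e i τ = coordY (exprIn (e τ.1) τ.2) i := by
  rw [yCoord, innerAt_eq (hf.mem _ hq), kappaFrame, exprIn_conjFrame, coordY]

lemma dproj_kappaTilde (hf : IsAdaptedFrame S U e) (hq : τ.1 ∈ U) :
    dproj τ (kappaTilde S e τ) = 0 :=
  dproj_vertLift _ (hf.contMDiffAt hq)

lemma exprDeriv_kappaTilde (hf : IsAdaptedFrame S U e) (hq : τ.1 ∈ U) :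
    exprDeriv e τ (kappaTilde S e τ)
      = kappa 0 - coordY (exprIn (e τ.1) τ.2) 0 • exprIn (e τ.1) τ.2 := by
  rw [kappaTilde, exprDeriv_vertLift _ (hf.contMDiffAt hq), exprIn_sub, exprIn_smul,
    innerAt_eq (hf.mem _ hq), kappaFrame, exprIn_conjFrame, innerEnd_comm, coordY]

lemma dproj_fieldA (hf : IsAdaptedFrame S U e) (hq : τ.1 ∈ U) :
    dproj τ (fieldA S nabla e τ) = e τ.1
      ((√3 * coordY (exprIn (e τ.1) τ.2) 0 * coordY (exprIn (e τ.1) τ.2) 2) • stdVec 0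
        - (coordY (exprIn (e τ.1) τ.2) 0 ^ 2 / 2 + coordY (exprIn (e τ.1) τ.2) 1 ^ 2 / 2
          - coordY (exprIn (e τ.1) τ.2) 2 ^ 2) • stdVec 2) := by
  have he := hf.contMDiffAt hq
  rw [fieldA, yCoord_eq hf hq, yCoord_eq hf hq, yCoord_eq hf hq, ContinuousLinearMap.map_sub,
    ContinuousLinearMap.map_smul, ContinuousLinearMap.map_smul, dproj_horLift he,
    dproj_horLift he, map_sub, map_smul, map_smul]

lemma exprDeriv_fieldA (hf : IsAdaptedFrame S U e) (hq : τ.1 ∈ U) :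
    exprDeriv e τ (fieldA S nabla e τ) =
      (√3 * coordY (exprIn (e τ.1) τ.2) 0 * coordY (exprIn (e τ.1) τ.2) 2) •
        parallelDeriv nabla e τ.1 (e τ.1 (stdVec 0)) (exprIn (e τ.1) τ.2)
        - (coordY (exprIn (e τ.1) τ.2) 0 ^ 2 / 2 + coordY (exprIn (e τ.1) τ.2) 1 ^ 2 / 2
          - coordY (exprIn (e τ.1) τ.2) 2 ^ 2) •
          parallelDeriv nabla e τ.1 (e τ.1 (stdVec 2)) (exprIn (e τ.1) τ.2) := by
  have he := hf.contMDiffAt hq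
  rw [fieldA, yCoord_eq hf hq, yCoord_eq hf hq, yCoord_eq hf hq, ContinuousLinearMap.map_sub,
    ContinuousLinearMap.map_smul, ContinuousLinearMap.map_smul, exprDeriv_horLift he,
    exprDeriv_horLift he]

lemma kappaTilde_eventuallyEq (hf : IsAdaptedFrame S U e) (hq : τ.1 ∈ U) :
    kappaTilde S e =ᶠ[𝓝 τ]
      VectorField.mpullback endModel 𝓘(ℝ, E5 × (E5 →L[ℝ] E5)) (endCoord τ.1 e) kappaModel := by
  refine eventuallyEq_mpullback_endCoord (hf.isOpen.mem_nhds hq)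
    (fun q hq => hf.contMDiffAt hq) fun ρ hρ hc => ?_
  rw [dproj_kappaTilde hf hρ, exprDeriv_kappaTilde hf hρ, map_zero, map_zero]
  rfl

lemma fieldA_eventuallyEq (hf : IsAdaptedFrame S U e) (hq : τ.1 ∈ U) :
    fieldA S nabla e =ᶠ[𝓝 τ] VectorField.mpullback endModel 𝓘(ℝ, E5 × (E5 →L[ℝ] E5))
      (endCoord τ.1 e) (fieldAModel nabla τ.1 e) := by
  refine eventuallyEq_mpullback_endCoord (hf.isOpen.mem_nhds hq)
    (fun q hq => hf.contMDiffAt hq) fun ρ hρ hc => ?_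
  rw [dproj_fieldA hf hρ, exprDeriv_fieldA hf hρ, ContinuousLinearEquiv.symm_apply_apply]
  have hinv : (extChartAt (𝓡 5) τ.1).symm (extChartAt (𝓡 5) τ.1 ρ.1) = ρ.1 :=
    (extChartAt (𝓡 5) τ.1).left_inv (by rwa [extChartAt_source])
  rw [fieldAModel, horModel, horModel, endCoord]
  dsimp only
  rw [hinv, map_sub, map_smul, map_smul]
  rfl

lemma contDiff_kappaModel : ContDiff ℝ ∞ kappaModel := by
  unfold kappaModel
  exact contDiff_const.prodMk (contDiff_const.sub
    (((contDiff_coordY 0).comp contDiff_snd).smul contDiff_snd))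

/-- The coordinate expression of a horizontal lift is smooth, at points over the base point of the
chart. -/
lemma contDiffAt_horModel [T2Space M]
    (hsmooth : CovariantDerivative.ContMDiffCovariantDerivative nabla ∞)
    (hf : IsAdaptedFrame S U e) (hp : p ∈ U) (x : E5) (F : E5 →L[ℝ] E5) :
    ContDiffAt ℝ ∞ (horModel nabla p e x) (extChartAt (𝓡 5) p p, F) := by
  have hφ : ContMDiffAt 𝓘(ℝ, E5 × (E5 →L[ℝ] E5)) (𝓡 5) ∞
      (fun z : E5 × (E5 →L[ℝ] E5) => (extChartAt (𝓡 5) p).symm z.1) (extChartAt (𝓡 5) p p, F) :=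
    ContMDiffAt.comp (I' := 𝓘(ℝ, E5)) (f := Prod.fst) (x := (extChartAt (𝓡 5) p p, F))
      (g := (extChartAt (𝓡 5) p).symm)
      ((contMDiffOn_extChartAt_symm p).contMDiffAt
        (extChartAt_target_mem_nhds (I := 𝓡 5) p : _ ∈ 𝓝 (extChartAt (𝓡 5) p p)))
      contDiff_fst.contMDiff.contMDiffAt
  have h1 := ContMDiffAt.comp_of_eq (contMDiffAt_frameMat (hf.contMDiffAt hp)) hφ
    (extChartAt_to_inv p)
  have h2 := ContMDiffAt.comp_of_eq (contMDiffAt_connForm hsmooth hf hp x) hφ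
    (extChartAt_to_inv p)
  have h1' := h1.contDiffAt
  have h2' := h2.contDiffAt
  refine ContDiffAt.prodMk (h1'.clm_apply contDiffAt_const) ?_
  exact (contDiffAt_snd.clm_comp h2').sub (h2'.clm_comp contDiffAt_snd)

lemma contDiffAt_fieldAModel [T2Space M]
    (hsmooth : CovariantDerivative.ContMDiffCovariantDerivative nabla ∞)
    (hf : IsAdaptedFrame S U e) (hp : p ∈ U) (F : E5 →L[ℝ] E5) :
    ContDiffAt ℝ ∞ (fieldAModel nabla p e) (extChartAt (𝓡 5) p p, F) := by
  have hy (i : Fin 3) : ContDiffAt ℝ ∞ (fun z : E5 × (E5 →L[ℝ] E5) => coordY z.2 i)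
      (extChartAt (𝓡 5) p p, F) := ((contDiff_coordY i).comp contDiff_snd).contDiffAt
  exact (((contDiffAt_const.mul (hy 0)).mul (hy 2)).smul
    (contDiffAt_horModel hsmooth hf hp (stdVec 0) F)).sub
    (((((hy 0).pow 2).div_const 2).add (((hy 1).pow 2).div_const 2)).sub ((hy 2).pow 2) |>.smul
      (contDiffAt_horModel hsmooth hf hp (stdVec 2) F))

lemma contMDiffOn_kappaTilde (hf : IsAdaptedFrame S U e) :
    ContMDiffOn endModel endModel.tangent ∞
      (fun τ => (⟨τ, kappaTilde S e τ⟩ : TangentBundle endModel (EndBundle M)))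
      (TotalSpace.proj ⁻¹' U) := by
  intro τ hτ
  have h := ContMDiffAt.mpullback_vectorField_preimage (m := ∞)
    (contMDiffAt_vectorSpace_iff_contDiffAt.mpr contDiff_kappaModel.contDiffAt)
    (contMDiffAt_endCoord (mem_chart_source E5 τ.1) (hf.contMDiffAt hτ))
    (isInvertible_mfderiv_endCoord (mem_chart_source E5 τ.1) (hf.contMDiffAt hτ)) le_rfl
  refine (h.congr_of_eventuallyEq ?_).contMDiffWithinAt
  filter_upwards [kappaTilde_eventuallyEq hf hτ] with ρ hρ
  rw [hρ]

lemma contMDiffOn_fieldA [T2Space M]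
    (hsmooth : CovariantDerivative.ContMDiffCovariantDerivative nabla ∞)
    (hf : IsAdaptedFrame S U e) :
    ContMDiffOn endModel endModel.tangent ∞
      (fun τ => (⟨τ, fieldA S nabla e τ⟩ : TangentBundle endModel (EndBundle M)))
      (TotalSpace.proj ⁻¹' U) := by
  intro τ hτ
  have h := ContMDiffAt.mpullback_vectorField_preimage (m := ∞)
    (contMDiffAt_vectorSpace_iff_contDiffAt.mpr
      (contDiffAt_fieldAModel hsmooth hf hτ (exprIn (e τ.1) τ.2)))
    (f := endCoord τ.1 e)
    (contMDiffAt_endCoord (mem_chart_source E5 τ.1) (hf.contMDiffAt hτ))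
    (isInvertible_mfderiv_endCoord (mem_chart_source E5 τ.1) (hf.contMDiffAt hτ)) le_rfl
  refine (h.congr_of_eventuallyEq ?_).contMDiffWithinAt
  filter_upwards [fieldA_eventuallyEq hf hτ] with ρ hρ
  rw [hρ]

/-! ### The Lie bracket -/

lemma connForm_eq_zero (hpar : ∀ x : E5, nabla (fun q => e q x) p = 0)
    (X : TangentSpace (𝓡 5) p) : connForm nabla e p X = 0 := by
  ext1 x
  simp [connForm_apply, hpar]

lemma coordY_kappa_add (s : ℝ) : coordY (kappa 2 + s • kappa 0) = ![s, 0, 1] := by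
  have : kappa 2 + s • kappa 0 = kap ![s, 0, 1] := by
    rw [kappa_eq_kap, kappa_eq_kap, ← kap_smul, ← kap_add]
    congr 1
    ext i
    fin_cases i <;> simp
  rw [this, coordY_kap]

lemma coordY_kappa_two : coordY (kappa 2) = ![0, 0, 1] := by
  rw [← coordY_kappa_add, zero_smul ℝ (kappa 0), add_zero]

lemma kappaModel_kappa_two (z : E5) : kappaModel (z, kappa 2) = (0, kappa 0) := by
  have h : coordY (kappa 2) 0 = 0 := by rw [coordY_kappa_two]; rfl
  rw [kappaModel, h, zero_smul ℝ (kappa 2), sub_zero]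

lemma horModel_of_parallel (hpar : ∀ x : E5, nabla (fun q => e q x) p = 0) (x : E5)
    (F : E5 →L[ℝ] E5) : horModel nabla p e x (extChartAt (𝓡 5) p p, F)
      = (frameMat p e p x, 0) := by
  rw [horModel]
  dsimp only
  rw [extChartAt_to_inv, parallelDeriv, connForm_eq_zero hpar, ContinuousLinearMap.comp_zero,
    ContinuousLinearMap.zero_comp, sub_zero]

/-- The field `A` along the line `κ₃ + s κ₁` in the fibre over a point at which the frame
is parallel. -/
lemma fieldAModel_of_parallel (hpar : ∀ x : E5, nabla (fun q => e q x) p = 0) (s : ℝ) :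
    fieldAModel nabla p e (extChartAt (𝓡 5) p p, kappa 2 + s • kappa 0)
      = ((√3 * s) • frameMat p e p (stdVec 0)
        - (s ^ 2 / 2 - 1) • frameMat p e p (stdVec 2), 0) := by
  have h0 : coordY (kappa 2 + s • kappa 0) 0 = s := by rw [coordY_kappa_add]; rfl
  have h1 : coordY (kappa 2 + s • kappa 0) 1 = 0 := by rw [coordY_kappa_add]; rfl
  have h2 : coordY (kappa 2 + s • kappa 0) 2 = 1 := by rw [coordY_kappa_add]; rfl
  rw [fieldAModel, horModel_of_parallel hpar, horModel_of_parallel hpar]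
  dsimp only
  rw [h0, h1, h2, Prod.smul_mk, Prod.smul_mk, Prod.mk_sub_mk, clm_smul_zero,
    clm_smul_zero, sub_zero]
  congr 3 <;> ring

lemma lieBracket_kappaModel_fieldAModel [T2Space M]
    (hsmooth : CovariantDerivative.ContMDiffCovariantDerivative nabla ∞)
    (hf : IsAdaptedFrame S U e) (hp : p ∈ U) (hpar : ∀ x : E5, nabla (fun q => e q x) p = 0) :
    VectorField.lieBracket ℝ kappaModel (fieldAModel nabla p e) (extChartAt (𝓡 5) p p, kappa 2)
      = (√3 • frameMat p e p (stdVec 0), 0) := by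
  have hA := (contDiffAt_fieldAModel hsmooth hf hp (kappa 2)).differentiableAt (by simp)
  have hK := (contDiff_kappaModel.contDiffAt
    (x := (extChartAt (𝓡 5) p p, kappa 2))).differentiableAt (by simp)
  have h2 : fieldAModel nabla p e (extChartAt (𝓡 5) p p, kappa 2)
      = (frameMat p e p (stdVec 2), 0) := by
    have h := fieldAModel_of_parallel hpar 0
    rw [zero_smul ℝ (kappa 0), add_zero] at h
    rw [h]
    congr 1
    module
  -- Both derivatives are line derivatives: the first one moves only the endomorphism, over `p`,
  -- and the second one only the base point, on which `κ̃₁` does not depend.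
  rw [VectorField.lieBracket, ← hA.lineDeriv_eq_fderiv, ← hK.lineDeriv_eq_fderiv,
    kappaModel_kappa_two, h2, lineDeriv, lineDeriv]
  have hsm (s : ℝ) : s • (0 : E5) = 0 := smul_zero s
  simp only [Prod.smul_mk, Prod.mk_add_mk, clm_smul_zero, hsm, add_zero, kappaModel_kappa_two,
    fieldAModel_of_parallel hpar, deriv_const, sub_zero]
  have ha : HasDerivAt (fun s : ℝ => √3 * s) √3 0 := by
    simpa using (hasDerivAt_id' (0 : ℝ)).const_mul √3
  have hb : HasDerivAt (fun s : ℝ => s ^ 2 / 2 - 1) 0 0 := by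
    simpa using ((hasDerivAt_pow 2 (0 : ℝ)).div_const 2).sub_const 1
  have hd := ((ha.smul_const (frameMat p e p (stdVec 0))).sub
    (hb.smul_const (frameMat p e p (stdVec 2)))).prodMk
    (hasDerivAt_const (0 : ℝ) (0 : E5 →L[ℝ] E5))
  rw [zero_smul, sub_zero] at hd
  exact hd.deriv

lemma IsNormalFrameAt.exprIn_eq (hF : IsNormalFrameAt S nabla τ U e) :
    exprIn (e τ.1) τ.2 = kappa 2 := by
  rw [← hF.kappa_three, kappaFrame, exprIn_conjFrame]

lemma mlieBracket_kappaModel_fieldAModel [T2Space M]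
    (hsmooth : CovariantDerivative.ContMDiffCovariantDerivative nabla ∞)
    (hF : IsNormalFrameAt S nabla τ U e) :
    VectorField.mlieBracket 𝓘(ℝ, E5 × (E5 →L[ℝ] E5)) kappaModel (fieldAModel nabla τ.1 e)
      (endCoord τ.1 e τ) = (√3 • frameMat τ.1 e τ.1 (stdVec 0), (0 : E5 →L[ℝ] E5)) := by
  refine (congrFun (VectorField.mlieBracketWithin_eq_lieBracketWithin (s := Set.univ)) _).trans ?_
  rw [VectorField.lieBracketWithin_univ, endCoord, hF.exprIn_eq]
  exact lieBracket_kappaModel_fieldAModel hsmooth hF.adaptedFrame hF.mem hF.parallel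

lemma mfderiv_endCoord_horLift_of_parallel (hF : IsNormalFrameAt S nabla τ U e) (x : E5) :
    (mfderiv endModel 𝓘(ℝ, E5 × (E5 →L[ℝ] E5)) (endCoord τ.1 e) τ (horLift nabla τ (e τ.1 x)) :
      E5 × (E5 →L[ℝ] E5)) = (frameMat τ.1 e τ.1 x, 0) := by
  have he := hF.adaptedFrame.contMDiffAt hF.mem
  rw [mfderiv_endCoord (mem_chart_source E5 τ.1) he, dproj_horLift he, exprDeriv_horLift he,
    parallelDeriv, connForm_eq_zero hF.parallel, ContinuousLinearEquiv.symm_apply_apply,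
    ContinuousLinearMap.comp_zero, ContinuousLinearMap.zero_comp, sub_zero]

lemma mlieBracket_kappaTilde_fieldA [T2Space M]
    (hsmooth : CovariantDerivative.ContMDiffCovariantDerivative nabla ∞)
    (hF : IsNormalFrameAt S nabla τ U e) :
    VectorField.mlieBracket endModel (kappaTilde S e) (fieldA S nabla e) τ
      = √3 • horLift nabla τ (e τ.1 (stdVec 0)) := by
  have hf := hF.adaptedFrame
  have he := hf.contMDiffAt hF.mem
  have h1 : MDifferentiableAt 𝓘(ℝ, E5 × (E5 →L[ℝ] E5)) 𝓘(ℝ, E5 × (E5 →L[ℝ] E5)).tangent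
      (fun z => (⟨z, kappaModel z⟩ : TangentBundle 𝓘(ℝ, E5 × (E5 →L[ℝ] E5)) _))
      (endCoord τ.1 e τ) :=
    (contMDiffAt_vectorSpace_iff_contDiffAt.mpr
      contDiff_kappaModel.contDiffAt).mdifferentiableAt (by simp)
  have h2 : MDifferentiableAt 𝓘(ℝ, E5 × (E5 →L[ℝ] E5)) 𝓘(ℝ, E5 × (E5 →L[ℝ] E5)).tangent
      (fun z => (⟨z, fieldAModel nabla τ.1 e z⟩ : TangentBundle 𝓘(ℝ, E5 × (E5 →L[ℝ] E5)) _))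
      (endCoord τ.1 e τ) :=
    (contMDiffAt_vectorSpace_iff_contDiffAt.mpr
      (contDiffAt_fieldAModel hsmooth hf hF.mem _)).mdifferentiableAt (by simp)
  have : IsManifold endModel (minSmoothness ℝ 2) (EndBundle M) :=
    IsManifold.of_le (n := ∞) (by simpa using two_le_infty)
  rw [(kappaTilde_eventuallyEq hf hF.mem).mlieBracket_vectorField_eq
    (fieldA_eventuallyEq hf hF.mem), ← VectorField.mpullback_mlieBracket h1 h2
    (contMDiffAt_endCoord (mem_chart_source E5 τ.1) he) (by simpa using two_le_infty)]
  refine (isInvertible_mfderiv_endCoord (mem_chart_source E5 τ.1) he).inverse_apply_eq.mpr ?_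
  rw [mlieBracket_kappaModel_fieldAModel hsmooth hF, ContinuousLinearMap.map_smul]
  refine Eq.symm ((congrArg (fun z : E5 × (E5 →L[ℝ] E5) => √3 • z)
    (mfderiv_endCoord_horLift_of_parallel hF (stdVec 0))).trans ?_)
  exact Prod.ext rfl (clm_smul_zero _)

end Manifold

/-! ### The two fields are sections of the contact distribution -/

lemma xiVec_apply_zero (y : Fin 3 → ℝ) : xiVec y 0 = (y 0 ^ 2 + y 1 ^ 2 - 2 * y 2 ^ 2) / 2 := rfl

lemma xiVec_apply_two (y : Fin 3 → ℝ) : xiVec y 2 = √3 * y 0 * y 2 := rfl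

lemma inner_stdVec (i : Fin 5) (x : E5) : inner ℝ (stdVec i) x = x i := by
  simp [stdVec, EuclideanSpace.inner_single_left]

lemma coordY_add (F G : E5 →L[ℝ] E5) : coordY (F + G) = coordY F + coordY G := by
  ext i
  simp only [coordY, innerEnd, add_apply, inner_add_left, Finset.sum_add_distrib, Pi.add_apply]
  ring

lemma coordY_smul (c : ℝ) (F : E5 →L[ℝ] E5) : coordY (c • F) = c • coordY F := by
  ext i
  simp only [coordY, innerEnd, smul_apply, real_inner_smul_left, ← Finset.mul_sum, Pi.smul_apply,
    smul_eq_mul]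
  ring

section Manifold

variable {M : Type*} [TopologicalSpace M] [ChartedSpace E5 M] [IsManifold (𝓡 5) ∞ M]
  {p : M} {e : ∀ q : M, E5 ≃L[ℝ] TangentSpace (𝓡 5) q} {nabla : Connection M}
  {τ : EndBundle M} {S : IrreducibleSO3Structure M} {U : Set M}

lemma horLift_zero (he : ∀ x, ContMDiffAt (𝓡 5) (𝓡 5).tangent ∞ (frameField e x) τ.1) :
    horLift nabla τ 0 = 0 := by
  have h := horLift_smul (nabla := nabla) he 0 0
  rwa [zero_smul, zero_smul] at h

lemma kappaTilde_mem (t : ℝ) (ε : ℤˣ) (n : ℕ) (hf : IsAdaptedFrame S U e) (hq : τ.1 ∈ U)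
    (hτ : τ ∈ twistorSpace S) : kappaTilde S e τ
      ∈ contactDistribution S nabla (twistorStructure S nabla t ε n) τ := by
  have he := hf.contMDiffAt hq
  obtain ⟨h1, h2⟩ := (mem_twistorSpace_iff hf hq).mp hτ
  set y := coordY (exprIn (e τ.1) τ.2) with hy
  have hv : exprIn (e τ.1) (kappaFrame e 0 τ.1
      - (innerAt S τ.1 (kappaFrame e 0 τ.1) τ.2 / 5) • τ.2) = kap (Pi.single 0 1 + (-y 0) • y) := by
    rw [exprIn_sub, exprIn_smul, innerAt_eq (hf.mem _ hq), kappaFrame, exprIn_conjFrame,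
      innerEnd_comm, ← coordY, ← hy, h1, kap_add, kap_smul, kappa_eq_kap]
    ext1 x
    simp [sub_eq_add_neg]
  refine ⟨⟨kappaFrame e 0 τ.1 - (innerAt S τ.1 (kappaFrame e 0 τ.1) τ.2 / 5) • τ.2,
    ⟨?_, ?_⟩, 0, ?_⟩, ?_⟩
  · rw [mem_Lambda23At_iff (hf.mem _ hq), hv]
    exact kap_mem_Lambda23 _
  · rw [innerAt_eq (hf.mem _ hq), hv, h1, innerEnd_kap]
    simp
    linear_combination (-y 0) * h2
  · rw [horLift_zero he, add_zero]
    rfl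
  · rw [twistorStructure_h_chi t ε n hf hq hτ, dproj_kappaTilde hf hq, map_zero, inner_zero_left]

/-- Horizontal lifts are tangent to the twistor space; they lie in the contact distribution if
they are orthogonal to `χ`. -/
lemma horLift_mem_iff (t : ℝ) (ε : ℤˣ) (n : ℕ) (hf : IsAdaptedFrame S U e) (hq : τ.1 ∈ U)
    (hτ : τ ∈ twistorSpace S) (x : E5) : horLift nabla τ (e τ.1 x)
      ∈ contactDistribution S nabla (twistorStructure S nabla t ε n) τ ↔
        inner ℝ x (xiVec (coordY (exprIn (e τ.1) τ.2))) = 0 := by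
  have he := hf.contMDiffAt hq
  have h0 : exprIn (e τ.1) 0 = kap 0 := by
    ext1 x
    simp [exprIn_apply, kap]
  have ht : horLift nabla τ (e τ.1 x) ∈ tangentTwistor S nabla τ := by
    refine ⟨0, ⟨?_, ?_⟩, _, by rw [vertLift_zero he, zero_add]⟩
    · rw [mem_Lambda23At_iff (hf.mem _ hq), h0]
      exact kap_mem_Lambda23 _
    · rw [innerAt_eq (hf.mem _ hq), h0, ((mem_twistorSpace_iff hf hq).mp hτ).1, innerEnd_kap]
      simp
  refine (and_iff_right ht).trans ?_
  rw [twistorStructure_h_chi t ε n hf hq hτ, dproj_horLift he,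
    ContinuousLinearEquiv.symm_apply_apply]

lemma fieldA_mem (t : ℝ) (ε : ℤˣ) (n : ℕ) (hf : IsAdaptedFrame S U e) (hq : τ.1 ∈ U)
    (hτ : τ ∈ twistorSpace S) : fieldA S nabla e τ
      ∈ contactDistribution S nabla (twistorStructure S nabla t ε n) τ := by
  have he := hf.contMDiffAt hq
  set a := √3 * yCoord S e 0 τ * yCoord S e 2 τ with ha
  set b := yCoord S e 0 τ ^ 2 / 2 + yCoord S e 1 τ ^ 2 / 2 - yCoord S e 2 τ ^ 2 with hb
  have h : fieldA S nabla e τ = horLift nabla τ (e τ.1 (a • stdVec 0 + (-b) • stdVec 2)) := by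
    rw [map_add, map_smul, map_smul, horLift_add he, horLift_smul he, horLift_smul he, neg_smul,
      ← sub_eq_add_neg]
    rfl
  rw [h, horLift_mem_iff t ε n hf hq hτ, inner_add_left, real_inner_smul_left,
    real_inner_smul_left, inner_stdVec, inner_stdVec, xiVec_apply_zero, xiVec_apply_two, ha, hb,
    yCoord_eq hf hq, yCoord_eq hf hq, yCoord_eq hf hq]
  ring

lemma xiVec_kappa_two : xiVec (coordY (kappa 2)) = (-1 : ℝ) • stdVec 0 := by
  rw [coordY_kappa_two]
  ext i
  fin_cases i <;> simp [xiVec, stdVec_apply]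

lemma mlieBracket_not_mem [T2Space M]
    (hsmooth : CovariantDerivative.ContMDiffCovariantDerivative nabla ∞) (t : ℝ) (ε : ℤˣ) (n : ℕ)
    (hF : IsNormalFrameAt S nabla τ U e) (hτ : τ ∈ twistorSpace S) :
    VectorField.mlieBracket endModel (kappaTilde S e) (fieldA S nabla e) τ
      ∉ contactDistribution S nabla (twistorStructure S nabla t ε n) τ := by
  have hf := hF.adaptedFrame
  rw [mlieBracket_kappaTilde_fieldA hsmooth hF, ← horLift_smul (hf.contMDiffAt hF.mem),
    ← map_smul, horLift_mem_iff t ε n hf hF.mem hτ, hF.exprIn_eq, xiVec_kappa_two,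
    real_inner_smul_left, inner_stdVec]
  simp [stdVec_apply]

lemma twistorStructure_chi_of_normal (t : ℝ) (ε : ℤˣ) (n : ℕ)
    (hF : IsNormalFrameAt S nabla τ U e) (hτ : τ ∈ twistorSpace S) :
    (twistorStructure S nabla t ε n).chi τ = -horLift nabla τ (e τ.1 (stdVec 0)) := by
  have hf := hF.adaptedFrame
  rw [twistorStructure_chi t ε n hf hF.mem hτ, hF.exprIn_eq, xiVec_kappa_two, map_smul,
    horLift_smul (hf.contMDiffAt hF.mem), neg_one_smul]

/-! ### Non-integrability -/

/-- The Frobenius obstruction. Suppose that the one-form `⟨T ·, N⟩` along `q` pulls back to zero.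
Differentiating `⟨T (Dq u), N⟩ = 0` along `v` and `⟨T (Dq v), N⟩ = 0` along `u`, the terms with the
symmetric second derivative of `q` agree; if `Dq v = 0` and `DN u = 0`, what remains is
`⟨T (Dq u), DN v⟩ = 0`. -/
lemma inner_fderiv_eq_zero {V E F : Type*} [NormedAddCommGroup V] [NormedSpace ℝ V]
    [NormedAddCommGroup E] [NormedSpace ℝ E] [NormedAddCommGroup F] [InnerProductSpace ℝ F]
    {q : V → E} {N : V → F} {T : E → E →L[ℝ] F} {w₀ u v : V}
    (hq : ContDiffAt ℝ 2 q w₀) (hT : DifferentiableAt ℝ T (q w₀)) (hN : DifferentiableAt ℝ N w₀)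
    (h : ∀ x, ∀ᶠ w in 𝓝 w₀, inner ℝ (T (q w) (fderiv ℝ q w x)) (N w) = 0)
    (hv : fderiv ℝ q w₀ v = 0) (hu : fderiv ℝ N w₀ u = 0) :
    inner ℝ (T (q w₀) (fderiv ℝ q w₀ u)) (fderiv ℝ N w₀ v) = 0 := by
  have hq1 : DifferentiableAt ℝ q w₀ := hq.differentiableAt (by simp)
  have hq2 : DifferentiableAt ℝ (fderiv ℝ q) w₀ :=
    (hq.fderiv_right (m := 1) (by norm_num)).differentiableAt (by simp)
  have hsymm : fderiv ℝ (fderiv ℝ q) w₀ u v = fderiv ℝ (fderiv ℝ q) w₀ v u :=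
    (hq.isSymmSndFDerivAt (by simp)).eq u v
  have hd (x : V) := ((hT.hasFDerivAt.comp w₀ hq1.hasFDerivAt).clm_apply
    (hq2.hasFDerivAt.clm_apply (hasFDerivAt_const x w₀))).inner ℝ hN.hasFDerivAt
  have hz (x z : V) := congrArg (fun A => A z) ((hd x).unique
    ((hasFDerivAt_const (0 : ℝ) w₀).congr_of_eventuallyEq (h x)))
  have h1 := hz u v
  have h2 := hz v u
  simp [hv, hu] at h1 h2
  rw [hsymm] at h2
  rw [h2, add_zero] at h1
  exact h1

end Manifold

section Manifold

variable {M : Type*} [TopologicalSpace M] [ChartedSpace E5 M] [IsManifold (𝓡 5) ∞ M]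
  {p : M} {e : ∀ q : M, E5 ≃L[ℝ] TangentSpace (𝓡 5) q} {nabla : Connection M}
  {τ : EndBundle M} {S : IrreducibleSO3Structure M} {U : Set M}

lemma contDiff_xiVec : ContDiff ℝ ∞ xiVec := by
  rw [contDiff_euclidean]
  intro i
  fin_cases i <;> simp [xiVec] <;> fun_prop

/-- The differential of `F ↦ ξ_F` at `κ₃` in the direction of `κ₁`. -/
lemma fderiv_xiVec_coordY : fderiv ℝ (fun F => xiVec (coordY F)) (kappa 2) (kappa 0)
    = √3 • stdVec 2 := by
  have hc : ContDiff ℝ ∞ coordY := contDiff_pi.mpr contDiff_coordY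
  have hd : DifferentiableAt ℝ (fun F => xiVec (coordY F)) (kappa 2) :=
    (contDiff_xiVec.comp hc).contDiffAt.differentiableAt (by simp)
  rw [← hd.lineDeriv_eq_fderiv, lineDeriv]
  have h : (fun s : ℝ => xiVec (coordY (kappa 2 + s • kappa 0)))
      = fun s : ℝ => (s ^ 2 / 2 - 1) • stdVec 0 + (√3 * s) • stdVec 2
        - (√3 / 2 * s ^ 2) • stdVec 3 := by
    ext s i
    rw [coordY_kappa_add]
    fin_cases i <;> simp [xiVec, stdVec_apply]
    ring
  have ha : HasDerivAt (fun s : ℝ => √3 * s) √3 0 := by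
    simpa using (hasDerivAt_id' (0 : ℝ)).const_mul √3
  have hb : HasDerivAt (fun s : ℝ => s ^ 2 / 2 - 1) 0 0 := by
    simpa using ((hasDerivAt_pow 2 (0 : ℝ)).div_const 2).sub_const 1
  have hc : HasDerivAt (fun s : ℝ => √3 / 2 * s ^ 2) 0 0 := by
    simpa using (hasDerivAt_pow 2 (0 : ℝ)).const_mul (√3 / 2)
  have hd := ((hb.smul_const (stdVec 0)).add (ha.smul_const (stdVec 2))).sub
    (hc.smul_const (stdVec 3))
  rw [zero_smul, zero_smul, zero_add, sub_zero] at hd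
  rw [h]
  exact hd.deriv

variable {V : Type*} [NormedAddCommGroup V] [NormedSpace ℝ V]

/-- The derivative of a map into `End(TM)`, in coordinates. -/
lemma fderiv_endCoord_comp {f : V → EndBundle M} {w : V} (hp : (f w).1 ∈ (chartAt E5 p).source)
    (he : ∀ x, ContMDiffAt (𝓡 5) (𝓡 5).tangent ∞ (frameField e x) (f w).1)
    (hf : MDifferentiableAt 𝓘(ℝ, V) endModel f w) (x : V) :
    fderiv ℝ (fun w => endCoord p e (f w)) w x
      = (frameMat p e (f w).1 ((e (f w).1).symm
          (dproj (f w) (mfderiv 𝓘(ℝ, V) endModel f w x))),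
        exprDeriv e (f w) (mfderiv 𝓘(ℝ, V) endModel f w x)) := by
  rw [← mfderiv_endCoord hp he, ← mfderiv_eq_fderiv]
  exact congrArg (fun A => A x)
    (mfderiv_comp w ((contMDiffAt_endCoord hp he).mdifferentiableAt (by simp)) hf)

/-- No integral manifold of the contact distribution passes through `τ`. For a map `f` onto such a
manifold, the vectors `A = E₃^h` and `κ̃₁ = κ₁` at `τ` are values of the differential of `f`. Under
`κ₁` the base point is stationary and the derivative of `ξ` is `√3 E₃`; along `A` the expression of
the endomorphism, hence `ξ`, is stationary. So `inner_fderiv_eq_zero` gives `⟨E₃, √3 E₃⟩ = 0`. -/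
lemma not_exists_integral_manifold (t : ℝ) (ε : ℤˣ) (n : ℕ)
    (hF : IsNormalFrameAt S nabla τ U e) (hτ : τ ∈ twistorSpace S) {W : Set V} {f : V → EndBundle M}
    {w₀ : V} (hW : IsOpen W) (hw₀ : w₀ ∈ W) (hfτ : f w₀ = τ)
    (hf : ContMDiffOn 𝓘(ℝ, V) endModel ∞ f W)
    (hfD : ∀ w ∈ W, f w ∈ twistorSpace S ∧ Set.range (mfderiv 𝓘(ℝ, V) endModel f w)
      = contactDistribution S nabla (twistorStructure S nabla t ε n) (f w)) : False := by
  subst hfτ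
  have ha := hF.adaptedFrame
  have hfa (w) (hw : w ∈ W) : MDifferentiableAt 𝓘(ℝ, V) endModel f w :=
    (hf.contMDiffAt (hW.mem_nhds hw)).mdifferentiableAt (by simp)
  obtain ⟨u, hu⟩ : fieldA S nabla e (f w₀) ∈ Set.range (mfderiv 𝓘(ℝ, V) endModel f w₀) :=
    (hfD w₀ hw₀).2 ▸ fieldA_mem t ε n ha hF.mem hτ
  obtain ⟨v, hv⟩ : kappaTilde S e (f w₀) ∈ Set.range (mfderiv 𝓘(ℝ, V) endModel f w₀) :=
    (hfD w₀ hw₀).2 ▸ kappaTilde_mem t ε n ha hF.mem hτ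
  set p := (f w₀).1 with hp
  let G : V → E5 × (E5 →L[ℝ] E5) := fun w => endCoord p e (f w)
  have hGs : ContDiffAt ℝ ∞ G w₀ := ContMDiffAt.contDiffAt
    ((contMDiffAt_endCoord (mem_chart_source E5 p) (ha.contMDiffAt hF.mem)).comp w₀
      (hf.contMDiffAt (hW.mem_nhds hw₀)))
  have hG : DifferentiableAt ℝ G w₀ := hGs.differentiableAt (by simp)
  have hG1 (w x) (h : DifferentiableAt ℝ G w) :
      fderiv ℝ (fun w => (G w).1) w x = (fderiv ℝ G w x).1 := by
    rw [h.hasFDerivAt.fst.fderiv]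
    rfl
  let T : E5 → E5 →L[ℝ] E5 := fun z => frameMatInv p e ((extChartAt (𝓡 5) p).symm z)
  have hT : DifferentiableAt ℝ T (G w₀).1 := by
    have := ContMDiffAt.comp_of_eq (x := extChartAt (𝓡 5) p p)
      (contMDiffAt_frameMatInv (ha.contMDiffAt hF.mem))
      ((contMDiffOn_extChartAt_symm (n := ∞) p).contMDiffAt (extChartAt_target_mem_nhds p))
      (extChartAt_to_inv p)
    exact this.contDiffAt.differentiableAt (by simp)
  have hξ : ContDiff ℝ ∞ (fun F => xiVec (coordY F)) :=
    contDiff_xiVec.comp (contDiff_pi.mpr contDiff_coordY)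
  let N : V → E5 := fun w => xiVec (coordY (G w).2)
  have hG0 : (G w₀).2 = kappa 2 := hF.exprIn_eq
  have hN : HasFDerivAt N (fderiv ℝ (fun F => xiVec (coordY F)) (kappa 2) ∘L
      (ContinuousLinearMap.snd ℝ E5 (E5 →L[ℝ] E5) ∘L fderiv ℝ G w₀)) w₀ := by
    rw [← hG0]
    exact (hξ.contDiffAt.differentiableAt (by simp)).hasFDerivAt.comp w₀ hG.hasFDerivAt.snd
  have hdG (x : V) := fderiv_endCoord_comp (p := p) (mem_chart_source E5 p)
    (ha.contMDiffAt hF.mem) (hfa w₀ hw₀) x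
  have hGu : fderiv ℝ G w₀ u = (frameMat p e p (stdVec 2), 0) := by
    refine (hdG u).trans ?_
    rw [hu, dproj_fieldA ha hF.mem, exprDeriv_fieldA ha hF.mem, hF.exprIn_eq, coordY_kappa_two,
      ContinuousLinearEquiv.symm_apply_apply, parallelDeriv, parallelDeriv,
      connForm_eq_zero hF.parallel, connForm_eq_zero hF.parallel, ContinuousLinearMap.comp_zero,
      ContinuousLinearMap.zero_comp, sub_zero, clm_smul_zero, clm_smul_zero, sub_zero]
    congr 2
    simp
  have hGv : fderiv ℝ G w₀ v = (0, kappa 0) := by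
    refine (hdG v).trans ?_
    rw [hv, dproj_kappaTilde ha hF.mem, exprDeriv_kappaTilde ha hF.mem, hF.exprIn_eq,
      coordY_kappa_two, map_zero, map_zero]
    congr 1
    ext1 x
    simp
  have hbase : (G w₀).1 = extChartAt (𝓡 5) p p := rfl
  have hTp : T (G w₀).1 = frameMatInv p e p := by
    rw [hbase]
    exact congrArg (frameMatInv p e) (extChartAt_to_inv p)
  have hmain := inner_fderiv_eq_zero (q := fun w => (G w).1) (N := N) (T := T) (u := u) (v := v)
    (hGs.fst.of_le two_le_infty) hT hN.differentiableAt (fun x => ?_) ?_ ?_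
  · rw [hG1 w₀ u hG, hGu, hTp, frameMatInv_frameMat (FiberBundle.mem_baseSet_trivializationAt' p),
      hN.fderiv] at hmain
    change inner ℝ (stdVec 2) (fderiv ℝ (fun F => xiVec (coordY F)) (kappa 2)
      (fderiv ℝ G w₀ v).2) = 0 at hmain
    rw [hGv, fderiv_xiVec_coordY, inner_stdVec] at hmain
    simp [stdVec_apply] at hmain
  · have hc : ContinuousAt (fun w => (f w).1) w₀ :=
      (mdifferentiableAt_proj_end (τ := f w₀)).continuousAt.comp (hfa w₀ hw₀).continuousAt
    filter_upwards [hW.mem_nhds hw₀, hc (ha.isOpen.mem_nhds hF.mem),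
      hc (chart_source_mem_nhds E5 p)] with w hw hwU hwc
    have hGw : DifferentiableAt ℝ G w := by
      have := ((contMDiffAt_endCoord (τ := f w) hwc (ha.contMDiffAt hwU)).mdifferentiableAt
        (by simp)).comp w (hfa w hw)
      exact this.differentiableAt
    have hmem : mfderiv 𝓘(ℝ, V) endModel f w x
        ∈ contactDistribution S nabla (twistorStructure S nabla t ε n) (f w) :=
      (hfD w hw).2 ▸ Set.mem_range_self x
    have hη := hmem.2
    rw [twistorStructure_h_chi t ε n ha hwU (hfD w hw).1] at hη
    have hTw : T (G w).1 = frameMatInv p e (f w).1 :=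
      congrArg (frameMatInv p e) ((extChartAt (𝓡 5) p).left_inv (by rwa [extChartAt_source]))
    have hb : (f w).1 ∈ (trivializationAt E5 (TangentSpace (𝓡 5) : M → Type _) p).baseSet := by
      rwa [TangentBundle.trivializationAt_baseSet]
    rw [hG1 w x hGw, hTw, fderiv_endCoord_comp hwc (ha.contMDiffAt hwU) (hfa w hw) x,
      frameMatInv_frameMat hb]
    exact hη
  · rw [hG1 w₀ v hG, hGv]
  · rw [hN.fderiv]
    change fderiv ℝ (fun F => xiVec (coordY F)) (kappa 2) (fderiv ℝ G w₀ u).2 = 0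
    rw [hGu, map_zero]

/-! ### Normal frames -/

/-- A smooth map into `SO(3)` changes an adapted frame into an adapted frame. -/
lemma IsAdaptedFrame.gauge (hf : IsAdaptedFrame S U e) {A : M → Matrix (Fin 3) (Fin 3) ℝ}
    (hA : ∀ q, A q ∈ Matrix.specialOrthogonalGroup (Fin 3) ℝ)
    {U' : Set M} (hU' : IsOpen U') (hsub : U' ⊆ U)
    (hs : ∀ x, ContMDiffOn (𝓡 5) 𝓘(ℝ, E5) ∞ (fun q => rhoFun (A q) x) U') :
    IsAdaptedFrame S U' (fun q => (rho (A q) (hA q)).trans (e q)) where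
  isOpen := hU'
  mem q hq := (S.mem_adapted_iff q (e q) (hf.mem q (hsub hq)) _).mpr
    ⟨_, rho_mem (A q) (hA q), fun _ => rfl⟩
  smooth x _ hq := (contMDiffAt_frame_apply (b := id) (hf.contMDiffAt (hsub hq)) contMDiffAt_id
    ((hs x).contMDiffAt (hU'.mem_nhds hq))).contMDiffWithinAt

/-- The connection form of an `SO(3)`-connection in an adapted frame takes values in `Λ²₃`. -/
lemma connForm_eq_kap (hnabla : IsSO3Connection S nabla) (hf : IsAdaptedFrame S U e) (hp : p ∈ U)
    (X : TangentSpace (𝓡 5) p) :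
    connForm nabla e p X = kap (coordY (connForm nabla e p X)) := by
  obtain ⟨a, ha, h⟩ := hnabla U e hf p hp X
  obtain ⟨z, rfl⟩ := exists_eq_skewMat ha
  have : connForm nabla e p X = kap z := by
    ext1 x
    apply mu_injective
    rw [mu_kap, ← h, nabla_frame (hf.contMDiffAt hp), ContinuousLinearEquiv.symm_apply_apply]
  rw [this, coordY_kap]

lemma rhoFun_kap {h : Matrix (Fin 3) (Fin 3) ℝ}
    (hh : h ∈ Matrix.specialOrthogonalGroup (Fin 3) ℝ) {y z : Fin 3 → ℝ}
    (hyz : h * skewMat z * hᵀ = skewMat y) (x : E5) :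
    rhoFun h (kap z x) = kap y (rhoFun h x) := by
  have h1 := transpose_mul_of_mem_SO3 hh
  apply mu_injective
  rw [mu_rhoFun hh, mu_kap, mu_kap, mu_rhoFun hh, ← hyz]
  have e1 : h * skewMat z * hᵀ * (h * mu x * hᵀ) = h * skewMat z * (hᵀ * h) * mu x * hᵀ := by
    simp only [mul_assoc]
  have e2 : h * mu x * hᵀ * (h * skewMat z * hᵀ) = h * mu x * (hᵀ * h) * skewMat z * hᵀ := by
    simp only [mul_assoc]
  rw [e1, e2, h1]
  simp only [mul_sub, sub_mul, mul_assoc, one_mul]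

lemma rhoFun_one (x : E5) : rhoFun 1 x = x := by
  rw [rhoFun, Matrix.transpose_one, one_mul, mul_one, muInv_mu]

/-- As `SO(3)` acts transitively on the sphere, a constant change of frame achieves `κ₃ = σ`. -/
lemma exists_adaptedFrame_kappaFrame {σ : EndBundle M} (hσ : σ ∈ twistorSpace S) :
    ∃ U e, IsAdaptedFrame S U e ∧ σ.1 ∈ U ∧ kappaFrame e 2 σ.1 = σ.2 := by
  obtain ⟨U, e, hU, hp, hmem, hs⟩ := S.exists_frame σ.1
  have hf : IsAdaptedFrame S U e := ⟨hU, hmem, hs⟩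
  obtain ⟨h1, h2⟩ := (mem_twistorSpace_iff hf hp).mp hσ
  obtain ⟨h, hh, hc⟩ := exists_conj_skewMat_eq h2
  refine ⟨U, _, hf.gauge (A := fun _ => h) (fun _ => hh) hU subset_rfl
    (fun x => contMDiffOn_const), hp, ?_⟩
  rw [← conjFrame_exprIn (e σ.1) σ.2, h1]
  ext1 X
  rw [conjFrame_apply]
  change e σ.1 (rhoFun h (kappa 2 ((rho h hh).symm ((e σ.1).symm X)))) = _
  have h3 : kappa 2 = kap ![0, 0, 1] := by
    rw [kappa_eq_kap]
    congr 1
    ext i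
    fin_cases i <;> simp
  rw [h3, rhoFun_kap hh hc, ← rho_apply h hh, ContinuousLinearEquiv.apply_symm_apply]

/-- Existence of normal frames. In the gauge given by the Cayley transform
of `v`, with `v p = 0`, the connection form at `p` is changed by `2 dv`. -/
lemma exists_isNormalFrameAt (hnabla : IsSO3Connection S nabla) {σ : EndBundle M}
    (hσ : σ ∈ twistorSpace S) : ∃ U e, IsNormalFrameAt S nabla σ U e := by
  obtain ⟨U, e, hf, hp, hκ⟩ := exists_adaptedFrame_kappaFrame hσ
  obtain ⟨v, hv0, hvs, hvd⟩ := exists_smooth_with_deriv σ.1 (0 : Fin 3 → ℝ)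
    { toFun := fun X => (-(1 / 2) : ℝ) • coordY (connForm nabla e σ.1 X)
      map_add' := fun X Y => by rw [connForm_add, coordY_add, smul_add]
      map_smul' := fun c X => by
        rw [connForm_smul, coordY_smul, smul_comm, RingHom.id_apply] }
  have hf' := hf.gauge (A := fun q => cay (v q)) (fun q => cay_mem (v q))
    (hf.isOpen.inter (chartAt E5 σ.1).open_source) Set.inter_subset_left
    (fun x => (contDiff_rhoFun_cay x).contMDiff.comp_contMDiffOn
      (hvs.mono Set.inter_subset_right))
  have hp' : σ.1 ∈ U ∩ (chartAt E5 σ.1).source := ⟨hp, mem_chart_source E5 σ.1⟩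
  have hcay (x : E5) : rhoFun (cay (v σ.1)) x = x := by rw [hv0, cay_zero, rhoFun_one]
  refine ⟨_, _, hf', hp', fun x => ?_, ?_⟩
  · ext1 X
    have h := nabla_eq nabla (hf.contMDiffAt hp)
      ((hf'.contMDiffAt hp' x).mdifferentiableAt (by simp)) X
    refine h.trans ?_
    have hcomp : (fun q => (e q).symm (((rho (cay (v q)) (cay_mem (v q))).trans (e q)) x))
        = (fun y => rhoFun (cay y) x) ∘ v := by
      ext1 q
      exact (e q).symm_apply_apply _
    have hderiv : mvfderiv (𝓡 5) ((fun y => rhoFun (cay y) x) ∘ v) σ.1 X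
        = fderiv ℝ (fun y => rhoFun (cay y) x) (v σ.1) (mvfderiv (𝓡 5) v σ.1 X) := by
      have hd := ((contDiff_rhoFun_cay x).contDiffAt (x := v σ.1)).differentiableAt (by simp)
      have hvm := ((hvs.contMDiffAt (chart_source_mem_nhds E5 σ.1)).mdifferentiableAt (by simp))
      exact congrArg (fun A => A X)
        (hd.hasFDerivAt.hasMFDerivAt.comp σ.1 hvm.hasMFDerivAt).mfderiv
    have hval : (e σ.1).symm (((rho (cay (v σ.1)) (cay_mem (v σ.1))).trans (e σ.1)) x) = x :=
      ((e σ.1).symm_apply_apply _).trans (hcay x)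
    rw [hcomp, hderiv, hvd, hv0, fderiv_rhoFun_cay, hval, connForm_eq_kap hnabla hf hp X]
    refine (congrArg (e σ.1) ?_).trans (map_zero (e σ.1))
    change (2 : ℝ) • kap ((-(1 / 2) : ℝ) • coordY (connForm nabla e σ.1 X)) x
      + kap (coordY (connForm nabla e σ.1 X)) x = 0
    rw [kap_smul, smul_apply]
    module
  · rw [← hκ]
    have hinv (x : E5) : (rho (cay (v σ.1)) (cay_mem (v σ.1))).symm x = x := by
      rw [ContinuousLinearEquiv.symm_apply_eq]
      exact (hcay x).symm
    ext1 X
    change e σ.1 (rhoFun (cay (v σ.1)) (kappa 2 ((rho (cay (v σ.1)) (cay_mem (v σ.1))).symm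
      ((e σ.1).symm X)))) = e σ.1 (kappa 2 ((e σ.1).symm X))
    rw [hcay, hinv]

lemma twistorSpace_nonempty [Nonempty M] (S : IrreducibleSO3Structure M) :
    (twistorSpace S).Nonempty := by
  obtain ⟨p⟩ := ‹Nonempty M›
  obtain ⟨U, e, hU, hp, hmem, hs⟩ := S.exists_frame p
  refine ⟨⟨p, conjFrame (e p) (kappa 2)⟩, (mem_twistorSpace_iff ⟨hU, hmem, hs⟩ hp).mpr ?_⟩
  dsimp only
  rw [exprIn_conjFrame, coordY_kappa_two]
  refine ⟨?_, by simp⟩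
  rw [← coordY_kappa_two]
  exact mem_Lambda23_iff.mp (kappa_eq_kap 2 ▸ kap_mem_Lambda23 _)

end Manifold

end SO3Twistor

end

open SO3Twistor in
theorem mainTheorem8 {M : Type*} [TopologicalSpace M] [T2Space M] [ChartedSpace SO3Twistor.E5 M]
    [IsManifold (𝓡 5) ∞ M] [Nonempty M]
    (S : SO3Twistor.IrreducibleSO3Structure M)
    (nabla : SO3Twistor.Connection M)
    (hsmooth : CovariantDerivative.ContMDiffCovariantDerivative nabla ∞)
    (hnabla : SO3Twistor.IsSO3Connection S nabla)
    (t : ℝ) (ht : 0 < t) (ε : ℤˣ) (n : ℕ) (hn : n = 1 ∨ n = 2)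
    (C : SO3Twistor.ContactMetricData M) (hC : C = SO3Twistor.twistorStructure S nabla t ε n)
    (D : ∀ σ : SO3Twistor.EndBundle M, Set (TangentSpace SO3Twistor.endModel σ))
    (hD : D = SO3Twistor.contactDistribution S nabla C) :
    ¬ SO3Twistor.IsIntegrable SO3Twistor.endModel 6 (SO3Twistor.twistorSpace S) D ∧
    ¬ SO3Twistor.IsInvolutive SO3Twistor.endModel (SO3Twistor.twistorSpace S) D ∧
    ∀ σ ∈ SO3Twistor.twistorSpace S,
      (∃ U e, SO3Twistor.IsNormalFrameAt S nabla σ U e) ∧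
      ∀ U e, SO3Twistor.IsNormalFrameAt S nabla σ U e →
        SO3Twistor.IsSectionOn SO3Twistor.endModel (SO3Twistor.twistorSpace S) D
          (TotalSpace.proj ⁻¹' U) (SO3Twistor.kappaTilde S e) ∧
        SO3Twistor.IsSectionOn SO3Twistor.endModel (SO3Twistor.twistorSpace S) D
          (TotalSpace.proj ⁻¹' U) (SO3Twistor.fieldA S nabla e) ∧
        VectorField.mlieBracket SO3Twistor.endModel (SO3Twistor.kappaTilde S e)
            (SO3Twistor.fieldA S nabla e) σ
          = √3 • SO3Twistor.horLift nabla σ (e σ.1 (SO3Twistor.stdVec 0)) ∧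
        VectorField.mlieBracket SO3Twistor.endModel (SO3Twistor.kappaTilde S e)
            (SO3Twistor.fieldA S nabla e) σ
          = -(√3 • C.chi σ) ∧
        VectorField.mlieBracket SO3Twistor.endModel (SO3Twistor.kappaTilde S e)
            (SO3Twistor.fieldA S nabla e) σ ∉ D σ := by
  subst hC hD
  have hκ (U e) (hf : IsAdaptedFrame S U e) : IsSectionOn endModel (twistorSpace S)
      (contactDistribution S nabla (twistorStructure S nabla t ε n)) (TotalSpace.proj ⁻¹' U)
      (kappaTilde S e) :=
    ⟨contMDiffOn_kappaTilde hf, fun τ hτ => kappaTilde_mem t ε n hf hτ.2 hτ.1⟩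
  have hA (U e) (hf : IsAdaptedFrame S U e) : IsSectionOn endModel (twistorSpace S)
      (contactDistribution S nabla (twistorStructure S nabla t ε n)) (TotalSpace.proj ⁻¹' U)
      (fieldA S nabla e) :=
    ⟨contMDiffOn_fieldA hsmooth hf, fun τ hτ => fieldA_mem t ε n hf hτ.2 hτ.1⟩
  obtain ⟨σ₀, hσ₀⟩ := twistorSpace_nonempty S
  obtain ⟨U₀, e₀, hF₀⟩ := exists_isNormalFrameAt hnabla hσ₀
  refine ⟨fun hint => ?_, fun hinv => ?_, fun σ hσ =>
    ⟨exists_isNormalFrameAt hnabla hσ, fun U e hF => ⟨hκ U e hF.adaptedFrame,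
      hA U e hF.adaptedFrame, mlieBracket_kappaTilde_fieldA hsmooth hF, ?_,
      mlieBracket_not_mem hsmooth t ε n hF hσ⟩⟩⟩
  · obtain ⟨W, f, hW, h0, hf0, hf, hfD⟩ := hint σ₀ hσ₀
    exact not_exists_integral_manifold t ε n hF₀ hσ₀ hW h0 hf0 hf
      fun w hw => ⟨(hfD w hw).1, (hfD w hw).2.2⟩
  · refine mlieBracket_not_mem hsmooth t ε n hF₀ hσ₀ (hinv _ ?_ _ _ (hκ U₀ e₀ hF₀.adaptedFrame)
      (hA U₀ e₀ hF₀.adaptedFrame) σ₀ ⟨hσ₀, hF₀.mem⟩)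
    exact hF₀.adaptedFrame.isOpen.preimage (FiberBundle.continuous_proj _ _)
  · rw [mlieBracket_kappaTilde_fieldA hsmooth hF, twistorStructure_chi_of_normal t ε n hF hσ,
      smul_neg, neg_neg]
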